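/- Let $(X_n)_{n\ge 1}$ be a strictly stationary, 1-dependent sequence of real random variables (for every $t\ge 1$, $\sigma(X_1,\dots,X_t)$ and $\sigma(X_{t+2},X_{t+3},\dots)$ are independent). For $x\in\mathbb R$ put $q_n=q_n(x)=\mathbb P(\max\{X_1,\dots,X_n\}\le x)$, $n\ge 1$. Let $0<\alpha\le 0.1$, let $t_2=t_2(\alpha)$ be the second real root, in increasing order, of $\alpha t^3-t+1=0$ (which has three real roots), let $l>t_2^3$, and put $\eta=1+l\alpha$. Define $$K(\alpha)=\frac{\dfrac{11-3\alpha}{(1-\alpha)^2}+2l(1+3\alpha)\dfrac{2+3l\alpha-\alpha(2-l\alpha)\eta^2}{(1-\alpha\eta^2)^3}}{1-\dfrac{2\alpha\eta}{(1-\alpha\eta^2)^2}},$$ $$L(\alpha)=3K(\alpha)(1+\alpha+3\alpha^2)\bigl[1+\alpha+3\alpha^2+K(\alpha)\alpha^3\bigr]+\alpha^6K(\alpha)^3+9\alpha(4+3\alpha+3\alpha^2)+55,$$ $$E(\alpha)=0.1+\frac{\eta^5[1+(1-2\alpha)\eta]^4[1+\alpha(\eta-2)][1+\eta+(1-3\alpha)\eta^2]}{2(1-\alpha\eta^2)^4\bigl[(1-\alpha\eta^2)^2-\alpha\eta^2(1+\eta-2\alpha\eta)^2\bigr]},\qquad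 \Gamma(\alpha)=L(\alpha)+E(\alpha),$$ where $l$ is such that the three quantities $1-\alpha\eta^2$, $1-\frac{2\alpha\eta}{(1-\alpha\eta^2)^2}$ and $(1-\alpha\eta^2)^2-\alpha\eta^2(1+\eta-2\alpha\eta)^2$ in the denominators are positive. If $q_1\ge 1-\alpha$ $(\ge 0.9)$, then for every $n\ge 3$ $$\left|q_n-\frac{6(q_1-q_2)^2+4q_3-3q_4}{(1+q_1-q_2+q_3-q_4+2q_1^2+3q_2^2-5q_1q_2)^n}\right|\le\bigl(\Gamma(\alpha)+nK(\alpha)\bigr)(1-q_1)^3 .$$ -/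

import Mathlib

open MeasureTheory ProbabilityTheory

/-- Strict stationarity of a sequence of real random variables: all finite-dimensional
distributions are invariant under shifts of time. -/
def StrictlyStationary {Ω : Type*} [MeasurableSpace Ω] (X : ℕ → Ω → ℝ) (μ : Measure Ω) : Prop :=
  ∀ n h : ℕ, μ.map (fun ω (i : Fin n) => X (i + h) ω) = μ.map (fun ω (i : Fin n) => X i ω)

/-- One-dependence. The sequence is indexed from `0`, so that `X i` is the `(i + 1)`-st variable:
for every `t ≥ 1` the sigma-algebra generated by the first `t` variables `X 0, …, X (t - 1)` is
independent of the one generated by all variables from the `(t + 2)`-nd on, `X (t + 1), …`. -/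
def OneDependent {Ω : Type*} [MeasurableSpace Ω] (X : ℕ → Ω → ℝ) (μ : Measure Ω) : Prop :=
  ∀ t : ℕ, 1 ≤ t →
    Indep (⨆ i ∈ Set.Iio t, MeasurableSpace.comap (X i) inferInstance)
      (⨆ i ∈ Set.Ici (t + 1), MeasurableSpace.comap (X i) inferInstance) μ

/-- `q_n(x)`, the probability that the maximum of the first `n` variables is at most `x`. -/
noncomputable def maxCDF {Ω : Type*} [MeasurableSpace Ω] (X : ℕ → Ω → ℝ) (μ : Measure Ω)
    (n : ℕ) (x : ℝ) : ℝ :=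
  μ.real {ω | ∀ i < n, X i ω ≤ x}

/-- `t` is the second (that is, the middle one) of the three real roots of `α t³ - t + 1 = 0`,
listed in increasing order. -/
def IsSecondRoot (α t : ℝ) : Prop :=
  ∃ t₁ t₃ : ℝ, t₁ < t ∧ t < t₃ ∧
    α * t₁ ^ 3 - t₁ + 1 = 0 ∧ α * t ^ 3 - t + 1 = 0 ∧ α * t₃ ^ 3 - t₃ + 1 = 0

/-- The coefficient `K(α)`, for a given choice of `l = l(α)`. -/
noncomputable def coeffK (α l : ℝ) : ℝ :=
  ((11 - 3 * α) / (1 - α) ^ 2 +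
      2 * l * (1 + 3 * α) *
        ((2 + 3 * l * α - α * (2 - l * α) * (1 + l * α) ^ 2) /
          (1 - α * (1 + l * α) ^ 2) ^ 3)) /
    (1 - 2 * α * (1 + l * α) / (1 - α * (1 + l * α) ^ 2) ^ 2)

/-- The coefficient `L(α)`, for a given choice of `l = l(α)`. -/
noncomputable def coeffL (α l : ℝ) : ℝ :=
  3 * coeffK α l * (1 + α + 3 * α ^ 2) * (1 + α + 3 * α ^ 2 + coeffK α l * α ^ 3) +
    α ^ 6 * coeffK α l ^ 3 + 9 * α * (4 + 3 * α + 3 * α ^ 2) + 55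

/-- The coefficient `E(α)` as a function of `α` and `η`. -/
noncomputable def coeffE (α η : ℝ) : ℝ :=
  0.1 + η ^ 5 * (1 + (1 - 2 * α) * η) ^ 4 * (1 + α * (η - 2)) *
      (1 + η + (1 - 3 * α) * η ^ 2) /
    (2 * (1 - α * η ^ 2) ^ 4 *
      ((1 - α * η ^ 2) ^ 2 - α * η ^ 2 * (1 + η - 2 * α * η) ^ 2))

/-- The coefficient `Γ(α) = L(α) + E(α)`, for a given choice of `l = l(α)`, with `η = 1 + l α`. -/
noncomputable def coeffGamma (α l : ℝ) : ℝ :=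
  coeffL α l + coeffE α (1 + l * α)

/-- The quantities in the denominators of `K(α)` and `Γ(α)` are positive. -/
def DenominatorsPos (α l : ℝ) : Prop :=
  0 < 1 - α * (1 + l * α) ^ 2 ∧
  0 < 1 - 2 * α * (1 + l * α) / (1 - α * (1 + l * α) ^ 2) ^ 2 ∧
  0 < (1 - α * (1 + l * α) ^ 2) ^ 2 -
        α * (1 + l * α) ^ 2 * (1 + (1 + l * α) - 2 * α * (1 + l * α)) ^ 2

/-! Let p_k be the probability that k consecutive variables exceed the level. Deciding whether the
variable between two blocks exceeds it, and using independence across the gap, gives a recursion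
whose alternating sum telescopes to C(z) D(z) = 1, where C(z) = 1 - z + p_1 z^2 - p_2 z^3 + ... and
D(z) = 1 + ∑ q_k z^(k+1) (`oneDepSeq_blockProb`). Dropping one variable gives p_(k+2) ≤ p_k p_1, so
C has a real root z close to 1 (`OneDepSeq.exists_root`), and q_n should behave like a constant
times z^(-n).

No complex analysis is needed: the zero is divided out formally. With C(zt) = (1 - t) U(t) and W(t)
= (1 - t) D(zt) one has U W = 1 (`conv_incr`). The coefficients of U are, up to sign, remainders of
C at its root, hence decay with powers of p_1; those of W are the increments of z^(k+1) q_k. So U W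
= 1 is a renewal equation with a small kernel, and the increments beyond z^4 q_3 have total size
O(p_1^3) (`sum_incr_tail_le`): z^n q_n is z^3 q_3 up to O(p_1^3).

The base μ in the denominator of the theorem is the second order expansion of z (`root_approx`), and
the numerator is that of μ^3 q_3 (`cube_expansion`), with p_3 and p_4 counted as second order.
Replacing z^(-n) by μ^(-n) costs n |z - μ|, whence the term linear in n. This yields explicit
constants in `OneDepSeq.approx`; it remains to see that Γ(α) and K(α) exceed them
(`coeff_dominate`), for which lower bounds on l and η suffice. -/

/-! ### Alternating sums with two-step geometric decay. -/

/-- Splitting off the first term leaves `e 0` minus the same sum for the shifted sequence, so each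
bound follows from the other one, and the factor `r` closes the geometric series. Monotonicity is
not assumed: the terms p_k z^(k+1) with z > 1 need not decrease. -/
theorem alternating_sum_bounds {r : ℝ} (hr : r < 1) (n : ℕ) :
    ∀ e : ℕ → ℝ, (∀ k, 0 ≤ e k) → (∀ k, e (k + 2) ≤ r * e k) →
      -(e 1 / (1 - r)) ≤ ∑ k ∈ Finset.range n, (-1) ^ k * e k ∧
      ∑ k ∈ Finset.range n, (-1) ^ k * e k ≤ e 0 / (1 - r) := by
  have h1 : 0 < 1 - r := by linarith
  induction n with
  | zero =>
    intro e he _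
    have h0 := div_nonneg (he 0) h1.le
    have h1' := div_nonneg (he 1) h1.le
    simp only [Finset.range_zero, Finset.sum_empty]
    exact ⟨by linarith, h0⟩
  | succ n ih =>
    intro e he h2
    obtain ⟨hl, hu⟩ := ih (fun k => e (k + 1)) (fun k => he _) (fun k => h2 _)
    have hs : ∑ k ∈ Finset.range (n + 1), (-1) ^ k * e k
        = e 0 - ∑ k ∈ Finset.range n, (-1) ^ k * e (k + 1) := by
      rw [Finset.sum_range_succ', sub_eq_add_neg, ← Finset.sum_neg_distrib, add_comm]
      simp only [pow_succ]
      simp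
    rw [hs]
    simp only [zero_add, Nat.reduceAdd] at hl hu
    have h3 : e 2 / (1 - r) ≤ r * e 0 / (1 - r) := div_le_div_of_nonneg_right (h2 0) h1.le
    have h4 : e 0 + r * e 0 / (1 - r) = e 0 / (1 - r) := by field_simp; ring
    exact ⟨by linarith [he 0], by linarith⟩

theorem alternating_sum_nonneg_le (n : ℕ) :
    ∀ e : ℕ → ℝ, (∀ k, 0 ≤ e k) → (∀ k, e (k + 1) ≤ e k) →
      0 ≤ ∑ k ∈ Finset.range n, (-1) ^ k * e k ∧
      ∑ k ∈ Finset.range n, (-1) ^ k * e k ≤ e 0 := by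
  induction n with
  | zero => intro e he _; simp [he 0]
  | succ n ih =>
    intro e he h2
    obtain ⟨hl, hu⟩ := ih (fun k => e (k + 1)) (fun k => he _) (fun k => h2 _)
    have hs : ∑ k ∈ Finset.range (n + 1), (-1) ^ k * e k
        = e 0 - ∑ k ∈ Finset.range n, (-1) ^ k * e (k + 1) := by
      rw [Finset.sum_range_succ', sub_eq_add_neg, ← Finset.sum_neg_distrib, add_comm]
      simp only [pow_succ]
      simp
    rw [hs]
    simp only [zero_add] at hl hu
    exact ⟨by linarith [h2 0], by linarith⟩

theorem sum_range_le_of_two_step {r : ℝ} (hr : r < 1) (n : ℕ) :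
    ∀ e : ℕ → ℝ, (∀ k, 0 ≤ e k) → (∀ k, e (k + 2) ≤ r * e k) →
      ∑ k ∈ Finset.range n, e k ≤ (e 0 + e 1) / (1 - r) := by
  have h1 : 0 < 1 - r := by linarith
  induction n with
  | zero =>
    intro e he _
    simpa using div_nonneg (add_nonneg (he 0) (he 1)) h1.le
  | succ n ih =>
    intro e he h2
    have hi := ih (fun k => e (k + 1)) (fun k => he _) (fun k => h2 _)
    rw [Finset.sum_range_succ']
    simp only [zero_add, Nat.reduceAdd] at hi
    have h3 : (e 1 + e 2) / (1 - r) ≤ (e 1 + r * e 0) / (1 - r) :=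
      div_le_div_of_nonneg_right (by linarith [h2 0]) h1.le
    have h4 : e 0 + (e 1 + r * e 0) / (1 - r) = (e 0 + e 1) / (1 - r) := by field_simp; ring
    linarith

theorem summable_of_two_step {r : ℝ} (hr : r < 1) {e : ℕ → ℝ}
    (he : ∀ k, 0 ≤ e k) (h2 : ∀ k, e (k + 2) ≤ r * e k) : Summable e :=
  summable_of_sum_range_le he fun n => sum_range_le_of_two_step hr n e he h2

theorem summable_alternating {e : ℕ → ℝ} (he : ∀ k, 0 ≤ e k) (hs : Summable e) :
    Summable fun k => (-1) ^ k * e k := by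
  refine Summable.of_norm ?_
  simpa [abs_of_nonneg (he _)] using hs

theorem alternating_tsum_bounds {r : ℝ} (hr : r < 1) {e : ℕ → ℝ}
    (he : ∀ k, 0 ≤ e k) (h2 : ∀ k, e (k + 2) ≤ r * e k) :
    -(e 1 / (1 - r)) ≤ ∑' k, (-1) ^ k * e k ∧ ∑' k, (-1) ^ k * e k ≤ e 0 / (1 - r) := by
  have ht := (summable_alternating he (summable_of_two_step hr he h2)).hasSum.tendsto_sum_nat
  exact ⟨ge_of_tendsto' ht fun n => (alternating_sum_bounds hr n e he h2).1,
    le_of_tendsto' ht fun n => (alternating_sum_bounds hr n e he h2).2⟩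

/-! ### The series C, D and a real root of C. -/

/-- Coefficients of `C(z) = 1 + ∑ (-1)^(k+1) p_k z^(k+1)`. -/
noncomputable def signedCoeff (p : ℕ → ℝ) : ℕ → ℝ
  | 0 => 1
  | k + 1 => (-1) ^ (k + 1) * p k

/-- Coefficients of `D(z) = 1 + ∑ q_k z^(k+1)`. -/
noncomputable def shiftedCoeff (q : ℕ → ℝ) : ℕ → ℝ
  | 0 => 1
  | k + 1 => q k

/-- The numerical properties of the probabilities `p k` that `k` consecutive variables all exceed
a level, and `q k` that none of them does, for a one-dependent stationary sequence with
`p 1 ≤ 1 / 10`. -/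
structure OneDepSeq (p q : ℕ → ℝ) : Prop where
  p_zero : p 0 = 1
  p_nonneg : ∀ k, 0 ≤ p k
  p_anti : ∀ k, p (k + 1) ≤ p k
  p_two : ∀ k, p (k + 2) ≤ p k * p 1
  p_one : p 1 ≤ 1 / 10
  q_nonneg : ∀ k, 0 ≤ q k
  conv : ∀ n, ∑ ij ∈ Finset.HasAntidiagonal.antidiagonal (n + 1),
    signedCoeff p ij.1 * shiftedCoeff q ij.2 = 0

namespace OneDepSeq

variable {p q : ℕ → ℝ}

theorem two_step (H : OneDepSeq p q) {z : ℝ} (hz : 0 ≤ z) (k : ℕ) :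
    p (k + 2) * z ^ (k + 2 + 1) ≤ p 1 * z ^ 2 * (p k * z ^ (k + 1)) := by
  have := mul_le_mul_of_nonneg_right (H.p_two k) (pow_nonneg hz (k + 2 + 1))
  calc _ ≤ _ := this
    _ = _ := by ring

theorem term_nonneg (H : OneDepSeq p q) {z : ℝ} (hz : 0 ≤ z) (k : ℕ) :
    0 ≤ p k * z ^ (k + 1) := mul_nonneg (H.p_nonneg k) (pow_nonneg hz _)

theorem ratio_le (H : OneDepSeq p q) {z : ℝ} (hz : 0 ≤ z) (hz' : z ≤ 1.154) :
    p 1 * z ^ 2 ≤ 0.1332 := by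
  have h1 : z ^ 2 ≤ 1.154 ^ 2 := pow_le_pow_left₀ hz hz' 2
  have := mul_le_mul H.p_one h1 (sq_nonneg z) (by norm_num)
  norm_num at this ⊢
  linarith

theorem ratio_nonneg (H : OneDepSeq p q) (z : ℝ) : 0 ≤ p 1 * z ^ 2 :=
  mul_nonneg (H.p_nonneg 1) (sq_nonneg z)

theorem summable_term (H : OneDepSeq p q) {z : ℝ} (hz : 0 ≤ z) (hz' : z ≤ 1.154) :
    Summable fun k => p k * z ^ (k + 1) :=
  summable_of_two_step (by linarith [H.ratio_le hz hz'])
    (H.term_nonneg hz) (H.two_step hz)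

/-- Intermediate value theorem. At 1 the terms decrease from p_0 = 1. At 1.154 the first term
exceeds 1 by 0.154, while the others take away at most 0.1 * 1.154^2 / (1 - 0.1332) < 0.154. -/
theorem exists_root (H : OneDepSeq p q) :
    ∃ z : ℝ, 1 ≤ z ∧ z ≤ 1.154 ∧ ∑' k, (-1) ^ k * (p k * z ^ (k + 1)) = 1 := by
  have hcont : ContinuousOn (fun z : ℝ => ∑' k, (-1) ^ k * (p k * z ^ (k + 1)))
      (Set.Icc 1 1.154) := by
    refine continuousOn_tsum (fun k => by fun_prop)
      (H.summable_term (z := 1.154) (by norm_num) le_rfl) ?_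
    intro k z hz
    have hz0 : 0 ≤ z := by linarith [hz.1]
    rw [norm_mul, norm_pow, norm_neg, norm_one, one_pow, one_mul,
      Real.norm_of_nonneg (H.term_nonneg hz0 k)]
    exact mul_le_mul_of_nonneg_left (pow_le_pow_left₀ hz0 hz.2 _) (H.p_nonneg k)
  have hone : ∑' k, (-1) ^ k * (p k * (1 : ℝ) ^ (k + 1)) ≤ 1 := by
    have ht := (summable_alternating (H.term_nonneg zero_le_one)
      (H.summable_term zero_le_one (by norm_num))).hasSum.tendsto_sum_nat
    refine le_of_tendsto' ht fun n => ?_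
    have := (alternating_sum_nonneg_le n (fun k => p k * (1 : ℝ) ^ (k + 1))
      (H.term_nonneg zero_le_one) (fun k => by simpa using H.p_anti k)).2
    simpa [H.p_zero] using this
  have htau : 1 ≤ ∑' k, (-1) ^ k * (p k * (1.154 : ℝ) ^ (k + 1)) := by
    have h0 : (0 : ℝ) ≤ 1.154 := by norm_num
    have hr := H.ratio_le h0 le_rfl
    have hs := summable_alternating (H.term_nonneg h0) (H.summable_term h0 le_rfl)
    rw [hs.tsum_eq_zero_add]
    have hb := (alternating_tsum_bounds (by linarith)
      (e := fun k => p (k + 1) * (1.154 : ℝ) ^ (k + 1 + 1))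
      (fun k => H.term_nonneg h0 _) (fun k => H.two_step h0 _)).2
    have hneg : ∑' k, (-1) ^ (k + 1) * (p (k + 1) * (1.154 : ℝ) ^ (k + 1 + 1))
        = -∑' k, (-1) ^ k * (p (k + 1) * (1.154 : ℝ) ^ (k + 1 + 1)) := by
      rw [← tsum_neg]
      congr 1; ext k; ring
    rw [hneg]
    have hq : p (0 + 1) * (1.154 : ℝ) ^ (0 + 1 + 1) / (1 - p 1 * 1.154 ^ 2) ≤ 0.154 := by
      rw [div_le_iff₀ (by linarith)]
      have := H.p_one
      norm_num at this ⊢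
      linarith
    simp only [pow_zero, H.p_zero, zero_add, pow_one, one_mul] at hq hb ⊢
    linarith
  obtain ⟨z, hz, hz'⟩ := intermediate_value_Icc (by norm_num) hcont ⟨hone, htau⟩
  exact ⟨z, hz.1, hz.2, hz'⟩

end OneDepSeq

/-! ### Dividing out the root: the renewal equation. -/

/-- Partial sums `∑_{j ≤ k} c_j z^j` of the series `C(z)`. -/
noncomputable def partialC (p : ℕ → ℝ) (z : ℝ) (k : ℕ) : ℝ :=
  1 - ∑ j ∈ Finset.range k, (-1) ^ j * (p j * z ^ (j + 1))

/-- Increments of `z^k d_k`. -/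
noncomputable def incr (q : ℕ → ℝ) (z : ℝ) : ℕ → ℝ
  | 0 => 1
  | k + 1 => z ^ (k + 1) * shiftedCoeff q (k + 1) - z ^ k * shiftedCoeff q k

namespace OneDepSeq

variable {p q : ℕ → ℝ}

theorem partialC_eq_tail (H : OneDepSeq p q) {z : ℝ} (hz : 0 ≤ z) (hz' : z ≤ 1.154)
    (hroot : ∑' k, (-1) ^ k * (p k * z ^ (k + 1)) = 1) (k : ℕ) :
    partialC p z k = (-1) ^ k * ∑' j, (-1) ^ j * (p (j + k) * z ^ (j + k + 1)) := by
  have hs := summable_alternating (H.term_nonneg hz) (H.summable_term hz hz')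
  have := hs.sum_add_tsum_nat_add k
  rw [hroot] at this
  rw [partialC, ← tsum_mul_left, sub_eq_of_eq_add' this.symm]
  congr 1; ext j; ring

/-- The factor 1 - t moves from C(zt) to D(zt): dividing by 1 - t turns coefficients into partial
sums, multiplying by it turns them into increments. -/
theorem conv_incr (H : OneDepSeq p q) (z : ℝ) (n : ℕ) :
    ∑ ij ∈ Finset.HasAntidiagonal.antidiagonal (n + 1), partialC p z ij.1 * incr q z ij.2 = 0 := by
  have hCD : PowerSeries.mk (signedCoeff p) * PowerSeries.mk (shiftedCoeff q) = 1 := by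
    ext m
    rw [PowerSeries.coeff_mul]
    simp only [PowerSeries.coeff_mk, PowerSeries.coeff_one]
    rcases m with _ | m
    · simp [signedCoeff, shiftedCoeff]
    · simpa using H.conv m
  have hres := congrArg (PowerSeries.rescale z) hCD
  rw [map_mul, map_one] at hres
  have hU : PowerSeries.rescale z (PowerSeries.mk (signedCoeff p))
      = PowerSeries.mk (partialC p z) * (1 - PowerSeries.X) := by
    ext m
    rw [mul_sub, mul_one, PowerSeries.coeff_rescale, map_sub]
    rcases m with _ | m
    · simp [signedCoeff, partialC]
    · rw [PowerSeries.coeff_succ_mul_X]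
      simp only [PowerSeries.coeff_mk, signedCoeff, partialC, Finset.sum_range_succ]
      ring
  have hW : PowerSeries.mk (incr q z)
      = (1 - PowerSeries.X) * PowerSeries.rescale z (PowerSeries.mk (shiftedCoeff q)) := by
    ext m
    rw [sub_mul, one_mul, map_sub, PowerSeries.coeff_rescale]
    rcases m with _ | m
    · simp [incr, shiftedCoeff]
    · rw [PowerSeries.coeff_succ_X_mul, PowerSeries.coeff_rescale]
      simp only [PowerSeries.coeff_mk, incr]
  have hUW : PowerSeries.mk (partialC p z) * PowerSeries.mk (incr q z) = 1 := by
    rw [hW, ← mul_assoc, ← hU, hres]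
  have := congrArg (PowerSeries.coeff (n + 1)) hUW
  rw [PowerSeries.coeff_mul] at this
  simpa [PowerSeries.coeff_one] using this

theorem incr_succ (H : OneDepSeq p q) (z : ℝ) (n : ℕ) :
    incr q z (n + 1)
      = -∑ i ∈ Finset.range (n + 1), partialC p z (i + 1) * incr q z (n - i) := by
  have := H.conv_incr z n
  rw [Finset.Nat.sum_antidiagonal_succ, Finset.Nat.sum_antidiagonal_eq_sum_range_succ_mk] at this
  simp only [partialC, Finset.range_zero, Finset.sum_empty, sub_zero, one_mul] at this
  simp only [partialC]
  linarith

theorem sum_incr (q : ℕ → ℝ) (z : ℝ) (n : ℕ) :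
    ∑ k ∈ Finset.range (n + 1), incr q z k = z ^ n * shiftedCoeff q n := by
  induction n with
  | zero => simp [incr, shiftedCoeff]
  | succ n ih => rw [Finset.sum_range_succ, ih]; simp [incr]

theorem tail_bounds (H : OneDepSeq p q) {z : ℝ} (hz : 0 ≤ z) (hz' : z ≤ 1.154)
    (hroot : ∑' k, (-1) ^ k * (p k * z ^ (k + 1)) = 1) (k : ℕ) :
    -(p (k + 1) * z ^ (k + 2) / (1 - p 1 * z ^ 2)) ≤ (-1) ^ k * partialC p z k ∧
      (-1) ^ k * partialC p z k ≤ p k * z ^ (k + 1) / (1 - p 1 * z ^ 2) := by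
  have hr := H.ratio_le hz hz'
  have hb := alternating_tsum_bounds (r := p 1 * z ^ 2) (by linarith)
      (e := fun j => p (j + k) * z ^ (j + k + 1))
      (fun j => H.term_nonneg hz _) (fun j => by
        have := H.two_step hz (j + k)
        rwa [show j + k + 2 = j + 2 + k by ring] at this)
  rw [H.partialC_eq_tail hz hz' hroot, ← mul_assoc, ← mul_pow]
  rw [zero_add, add_comm 1 k, show k + 1 + 1 = k + 2 by ring] at hb
  simpa using hb

theorem p_succ_le (H : OneDepSeq p q) (k : ℕ) : p (k + 1) ≤ p 1 ^ (k / 2 + 1) := by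
  induction k using Nat.twoStepInduction with
  | zero => simp
  | one => simpa using H.p_anti 1
  | more k ih _ =>
    have h1 := H.p_two (k + 1)
    have h2 := mul_le_mul_of_nonneg_right ih (H.p_nonneg 1)
    rw [show (k + 2) / 2 + 1 = k / 2 + 1 + 1 by omega, pow_succ]
    exact h1.trans h2

theorem term_succ_le (H : OneDepSeq p q) {z : ℝ} (hz : 1 ≤ z) (k : ℕ) :
    p (k + 1) * z ^ (k + 2) ≤ z * (p 1 * z ^ 2) ^ (k / 2 + 1) := by
  have h1 : p (k + 1) * z ^ (k + 2) ≤ p 1 ^ (k / 2 + 1) * z ^ (2 * (k / 2 + 1) + 1) :=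
    mul_le_mul (H.p_succ_le k) (pow_le_pow_right₀ hz (by omega)) (by positivity)
      (pow_nonneg (H.p_nonneg 1) _)
  calc _ ≤ _ := h1
    _ = _ := by rw [mul_pow, ← pow_mul]; ring

/-- Since C(z) = 0, a partial sum is minus the remainder, an alternating series with two-step ratio
p_1 z^2. The order in p_1 rises only at every second index, hence the exponent `k / 2`. -/
theorem abs_partialC_le (H : OneDepSeq p q) {z : ℝ} (hz : 1 ≤ z) (hz' : z ≤ 1.154)
    (hroot : ∑' k, (-1) ^ k * (p k * z ^ (k + 1)) = 1) (k : ℕ) :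
    |partialC p z (k + 1)| ≤
      z * (p 1 * z ^ 2) / (1 - p 1 * z ^ 2) * (p 1 * z ^ 2) ^ (k / 2) := by
  have hz0 : 0 ≤ z := by linarith
  have hr := H.ratio_le hz0 hz'
  have hr0 := H.ratio_nonneg z
  have h1 : 0 < 1 - p 1 * z ^ 2 := by linarith
  have hb := H.tail_bounds hz0 hz' hroot (k + 1)
  have ha : |partialC p z (k + 1)| = |(-1) ^ (k + 1) * partialC p z (k + 1)| := by
    rw [abs_mul, abs_pow, abs_neg, abs_one, one_pow, one_mul]
  have e1 := H.term_succ_le hz k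
  have e2 := H.term_succ_le hz (k + 1)
  have e3 : z * (p 1 * z ^ 2) ^ ((k + 1) / 2 + 1) ≤ z * (p 1 * z ^ 2) ^ (k / 2 + 1) :=
    mul_le_mul_of_nonneg_left (pow_le_pow_of_le_one hr0 (by linarith) (by omega)) hz0
  have e4 : z * (p 1 * z ^ 2) / (1 - p 1 * z ^ 2) * (p 1 * z ^ 2) ^ (k / 2)
      = z * (p 1 * z ^ 2) ^ (k / 2 + 1) / (1 - p 1 * z ^ 2) := by rw [pow_succ]; ring
  rw [ha, e4, abs_le]
  constructor
  · exact le_trans (neg_le_neg (div_le_div_of_nonneg_right (e2.trans e3) h1.le)) hb.1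
  · exact hb.2.trans (div_le_div_of_nonneg_right e1 h1.le)

theorem root_sub_one_le (H : OneDepSeq p q) {z : ℝ} (hz : 1 ≤ z) (hz' : z ≤ 1.154)
    (hroot : ∑' k, (-1) ^ k * (p k * z ^ (k + 1)) = 1) : z - 1 ≤ p 1 * z ^ 3 := by
  have hz0 : 0 ≤ z := by linarith
  have hr := H.ratio_le hz0 hz'
  have hb := (H.tail_bounds hz0 hz' hroot 1).2
  -- With r = p_1 z^2 this reads (z - 1)(1 - r) ≤ r, which is equivalent to z - 1 ≤ r z.
  rw [le_div_iff₀ (by linarith)] at hb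
  simp only [partialC, Finset.sum_range_one, pow_zero, pow_one, zero_add, H.p_zero] at hb
  norm_num at hb
  nlinarith

end OneDepSeq

/-! ### Tail of the solution of a renewal equation. -/

theorem sum_conv_le {v y : ℕ → ℝ} (hv : ∀ k, 0 ≤ v k) (hy : ∀ k, 0 ≤ y k) (M : ℕ) :
    ∑ k ∈ Finset.range M, ∑ i ∈ Finset.range k, v i * y (k - 1 - i)
      ≤ (∑ i ∈ Finset.range M, v i) * ∑ k ∈ Finset.range M, y k := by
  rcases M with _ | M
  · simp
  rw [Finset.sum_range_succ']
  simp only [Finset.range_zero, Finset.sum_empty, add_zero, Nat.add_sub_cancel]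
  rw [Finset.sum_range_diag_flip M (fun i j => v i * y j), Finset.sum_mul]
  simp only [← Finset.mul_sum]
  calc ∑ m ∈ Finset.range M, v m * ∑ k ∈ Finset.range (M - m), y k
      ≤ ∑ m ∈ Finset.range M, v m * ∑ k ∈ Finset.range (M + 1), y k := by
        refine Finset.sum_le_sum fun m _ => mul_le_mul_of_nonneg_left ?_ (hv m)
        exact Finset.sum_le_sum_of_subset_of_nonneg
          (Finset.range_mono (by omega)) fun i _ _ => hy i
    _ ≤ _ := Finset.sum_le_sum_of_subset_of_nonneg
          (Finset.range_mono (by omega))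
          fun i _ _ => mul_nonneg (hv i) (Finset.sum_nonneg fun j _ => hy j)

/-- A sequence solving `w (n + 1) = -∑ u i w (n - i)` has a small tail when the sums of `|u i|`
from given indices on are bounded by `s₁, …, s₅`. -/
theorem renewal_tail_le {u w : ℕ → ℝ}
    (hrec : ∀ n, w (n + 1) = -∑ i ∈ Finset.range (n + 1), u i * w (n - i))
    {s₁ s₂ s₃ s₄ s₅ : ℝ}
    (h₁ : ∀ M, ∑ i ∈ Finset.range M, |u i| ≤ s₁)
    (h₂ : ∀ M, ∑ i ∈ Finset.range M, |u (i + 1)| ≤ s₂)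
    (h₃ : ∀ M, ∑ i ∈ Finset.range M, |u (i + 2)| ≤ s₃)
    (h₄ : ∀ M, ∑ i ∈ Finset.range M, |u (i + 3)| ≤ s₄)
    (h₅ : ∀ M, ∑ i ∈ Finset.range M, |u (i + 4)| ≤ s₅) (M : ℕ) :
    (∑ k ∈ Finset.range M, |w (k + 5)|) * (1 - s₁) ≤
      s₁ * |w 4| + s₂ * |w 3| + s₃ * |w 2| + s₄ * |w 1| + s₅ * |w 0| := by
  -- The terms involving w_5 and later form a convolution; the other five involve w_0, ..., w_4.
  -- After summation over `k` the convolution is at most s₁ times the tail itself, and moves to the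
  -- left-hand side.
  have hk : ∀ k, |w (k + 5)| ≤ ∑ i ∈ Finset.range k, |u i| * |w (k - 1 - i + 5)|
      + (|u k| * |w 4| + |u (k + 1)| * |w 3| + |u (k + 2)| * |w 2| + |u (k + 3)| * |w 1|
        + |u (k + 4)| * |w 0|) := by
    intro k
    rw [hrec (k + 4), abs_neg]
    refine (Finset.abs_sum_le_sum_abs _ _).trans (le_of_eq ?_)
    simp only [Finset.sum_range_succ, abs_mul]
    have : ∑ i ∈ Finset.range k, |u i| * |w (k + 4 - i)|
        = ∑ i ∈ Finset.range k, |u i| * |w (k - 1 - i + 5)| := by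
      refine Finset.sum_congr rfl fun i hi => ?_
      have := Finset.mem_range.1 hi
      rw [show k + 4 - i = k - 1 - i + 5 by omega]
    rw [this, show k + 4 - k = 4 by omega, show k + 4 - (k + 1) = 3 by omega,
      show k + 4 - (k + 2) = 2 by omega, show k + 4 - (k + 3) = 1 by omega, Nat.sub_self]
    ring
  have hsum := Finset.sum_le_sum fun k (_ : k ∈ Finset.range M) => hk k
  simp only [Finset.sum_add_distrib, ← Finset.sum_mul] at hsum
  have hc := sum_conv_le (v := fun k => |u k|) (y := fun k => |w (k + 5)|)
    (fun k => abs_nonneg _) (fun k => abs_nonneg _) M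
  have hY : 0 ≤ ∑ k ∈ Finset.range M, |w (k + 5)| := Finset.sum_nonneg fun k _ => abs_nonneg _
  have g0 := mul_le_mul_of_nonneg_right (h₁ M) hY
  have g1 := mul_le_mul_of_nonneg_right (h₁ M) (abs_nonneg (w 4))
  have g2 := mul_le_mul_of_nonneg_right (h₂ M) (abs_nonneg (w 3))
  have g3 := mul_le_mul_of_nonneg_right (h₃ M) (abs_nonneg (w 2))
  have g4 := mul_le_mul_of_nonneg_right (h₄ M) (abs_nonneg (w 1))
  have g5 := mul_le_mul_of_nonneg_right (h₅ M) (abs_nonneg (w 0))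
  linarith

theorem sum_shift_le {u : ℕ → ℝ} {m : ℕ} {a b : ℝ} (ha : |u m| ≤ a)
    (hb : ∀ M, ∑ i ∈ Finset.range M, |u (i + (m + 1))| ≤ b) (M : ℕ) :
    ∑ i ∈ Finset.range M, |u (i + m)| ≤ a + b := by
  have h1 : ∑ i ∈ Finset.range M, |u (i + m)| ≤ ∑ i ∈ Finset.range (M + 1), |u (i + m)| := by
    rw [Finset.sum_range_succ]; linarith [abs_nonneg (u (M + m))]
  rw [Finset.sum_range_succ'] at h1
  have h2 := hb M
  simp only [add_assoc, zero_add, add_comm 1 m] at h1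
  linarith

/-- `renewal_tail_le` for coefficients decaying like powers of `x`. -/
theorem renewal_tail_le_pow {u w : ℕ → ℝ} (hw0 : w 0 = 1)
    (hrec : ∀ n, w (n + 1) = -∑ i ∈ Finset.range (n + 1), u i * w (n - i))
    {x η β γ σ₁ σ₂ σ₃ σ₄ σ₅ ω₂ ω₃ ω₄ : ℝ} (hx : 0 ≤ x) (hη : 0 ≤ η) (hβ : 0 ≤ β) (hγ : 0 ≤ γ)
    (hσ₅ : 0 ≤ σ₅) (hσ₄ : σ₄ = γ + x * σ₅) (hσ₃ : σ₃ = γ + σ₄) (hσ₂ : σ₂ = β + x * σ₃)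
    (hσ₁ : σ₁ = η + σ₂) (hω₂ : ω₂ = x * η * η + β) (hω₃ : ω₃ = η * ω₂ + β * η + γ)
    (hω₄ : ω₄ = x * η * ω₃ + β * ω₂ + x * γ * η + γ)
    (u0 : |u 0| ≤ x * η) (u1 : |u 1| ≤ x * β) (u2 : |u 2| ≤ x ^ 2 * γ) (u3 : |u 3| ≤ x ^ 2 * γ)
    (H5 : ∀ M, ∑ i ∈ Finset.range M, |u (i + 4)| ≤ x ^ 3 * σ₅) (M : ℕ) :
    (∑ k ∈ Finset.range M, |w (k + 5)|) * (1 - x * σ₁) ≤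
      x ^ 3 * (σ₁ * ω₄ + σ₂ * ω₃ + σ₃ * ω₂ + σ₄ * η + σ₅) := by
  have p4 : 0 ≤ σ₄ := by rw [hσ₄]; positivity
  have p3 : 0 ≤ σ₃ := by rw [hσ₃]; positivity
  have p2 : 0 ≤ σ₂ := by rw [hσ₂]; positivity
  have p1 : 0 ≤ σ₁ := by rw [hσ₁]; positivity
  have H4 := sum_shift_le u3 H5
  have H3 := sum_shift_le u2 H4
  have H2 := sum_shift_le u1 H3
  have H1 := sum_shift_le u0 H2
  have hY := renewal_tail_le hrec H1 H2 H3 H4 H5 M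
  rw [show x * η + (x * β + (x ^ 2 * γ + (x ^ 2 * γ + x ^ 3 * σ₅))) = x * σ₁ by
      rw [hσ₁, hσ₂, hσ₃, hσ₄]; ring,
    show x * β + (x ^ 2 * γ + (x ^ 2 * γ + x ^ 3 * σ₅)) = x * σ₂ by
      rw [hσ₂, hσ₃, hσ₄]; ring,
    show x ^ 2 * γ + (x ^ 2 * γ + x ^ 3 * σ₅) = x ^ 2 * σ₃ by rw [hσ₃, hσ₄]; ring,
    show x ^ 2 * γ + x ^ 3 * σ₅ = x ^ 2 * σ₄ by rw [hσ₄]; ring] at hY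
  -- The first values are computed from the recursion: w_1 and w_2 are of order x, w_3 and w_4 of
  -- order x^2. Every product on the right of `hY` is then of order x^3, which is why the tail
  -- starts at index 5.
  have r1 := hrec 0
  have r2 := hrec 1
  have r3 := hrec 2
  have r4 := hrec 3
  simp only [Finset.sum_range_succ, Finset.sum_range_zero, zero_add, Nat.reduceSub, Nat.reduceAdd,
    hw0, mul_one] at r1 r2 r3 r4
  have n2 := fun k => abs_nonneg (w k)
  have e1 : |w 1| ≤ x * η := by rw [r1, abs_neg]; exact u0
  have e2 : |w 2| ≤ x * ω₂ := by
    rw [r2, abs_neg]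
    refine (abs_add_le _ _).trans ?_
    rw [abs_mul]
    have := mul_le_mul u0 e1 (n2 1) (mul_nonneg hx hη)
    rw [hω₂]; linarith
  have e3 : |w 3| ≤ x ^ 2 * ω₃ := by
    rw [r3, abs_neg]
    refine (abs_add_three _ _ _).trans ?_
    rw [abs_mul, abs_mul]
    have h1 := mul_le_mul u0 e2 (n2 2) (mul_nonneg hx hη)
    have h2 := mul_le_mul u1 e1 (n2 1) (mul_nonneg hx hβ)
    rw [hω₃]; linarith
  have e4 : |w 4| ≤ x ^ 2 * ω₄ := by
    rw [r4, abs_neg]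
    refine (abs_add_le _ _).trans ((add_le_add_left (abs_add_three _ _ _) _).trans ?_)
    rw [abs_mul, abs_mul, abs_mul]
    have h1 := mul_le_mul u0 e3 (n2 3) (mul_nonneg hx hη)
    have h2 := mul_le_mul u1 e2 (n2 2) (mul_nonneg hx hβ)
    have h3 := mul_le_mul u2 e1 (n2 1) (mul_nonneg (sq_nonneg x) hγ)
    rw [hω₄]; linarith
  have f4 := mul_le_mul_of_nonneg_left e4 (mul_nonneg hx p1)
  have f3 := mul_le_mul_of_nonneg_left e3 (mul_nonneg hx p2)
  have f2 := mul_le_mul_of_nonneg_left e2 (mul_nonneg (sq_nonneg x) p3)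
  have f1 := mul_le_mul_of_nonneg_left e1 (mul_nonneg (sq_nonneg x) p4)
  rw [hw0, abs_one, mul_one] at hY
  linarith

/-! ### Chord bounds and the numerical constant of the tail. -/

/-- `x` is nonnegative and lies below the chord from `(0, a)` to `(1, b)` at `t`. -/
structure ChordBound (t x a b : ℝ) : Prop where
  nonneg : 0 ≤ x
  le : x ≤ a + (b - a) * t
  left : 0 ≤ a
  mono : a ≤ b

namespace ChordBound

variable {t x y a b c d : ℝ}

theorem add (hx : ChordBound t x a b) (hy : ChordBound t y c d) :
    ChordBound t (x + y) (a + c) (b + d) where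
  nonneg := add_nonneg hx.nonneg hy.nonneg
  le := by linarith [hx.le, hy.le]
  left := add_nonneg hx.left hy.left
  mono := add_le_add hx.mono hy.mono

/-- A product of two affine functions with nonnegative slopes is convex, hence lies below its own
chord on [0, 1]. With t = 10 x, an upper bound for a nested expression thus reduces to numerical
evaluation at x = 0 and x = 1/10. -/
theorem mul (h0 : 0 ≤ t) (h1 : t ≤ 1) (hx : ChordBound t x a b) (hy : ChordBound t y c d) :
    ChordBound t (x * y) (a * c) (b * d) where
  nonneg := mul_nonneg hx.nonneg hy.nonneg
  le := by
    have h := mul_le_mul hx.le hy.le hy.nonneg (hx.nonneg.trans hx.le)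
    have h2 : 0 ≤ (b - a) * (d - c) * (t * (1 - t)) :=
      mul_nonneg (mul_nonneg (sub_nonneg.2 hx.mono) (sub_nonneg.2 hy.mono))
        (mul_nonneg h0 (sub_nonneg.2 h1))
    linarith
  left := mul_nonneg hx.left hy.left
  mono := mul_le_mul hx.mono hy.mono hy.left (hx.left.trans hx.mono)

theorem weaken (h0 : 0 ≤ t) (h1 : t ≤ 1) (hx : ChordBound t x a b) (hac : a ≤ c) (hbd : b ≤ d)
    (hcd : c ≤ d) : ChordBound t x c d where
  nonneg := hx.nonneg
  le := by
    have := mul_nonneg (sub_nonneg.2 hac) (sub_nonneg.2 h1)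
    have := mul_nonneg (sub_nonneg.2 hbd) h0
    linarith [hx.le]
  left := hx.left.trans hac
  mono := hcd

theorem le_right (h1 : t ≤ 1) (hx : ChordBound t x a b) : x ≤ b := by
  have := mul_nonneg (sub_nonneg.2 hx.mono) (sub_nonneg.2 h1)
  linarith [hx.le]

end ChordBound

/-- From v = 1 + x z^2 v: the crude bound v ≤ 1.154, inserted on the right, gives an affine bound in
x. -/
theorem chordBound_inv {x z v : ℝ} (hx0 : 0 ≤ x) (hz0 : 0 ≤ z) (hz' : z ≤ 1.154)
    (hr : x * z ^ 2 ≤ 0.1332) (hv : v * (1 - x * z ^ 2) = 1) :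
    ChordBound (10 * x) v 1 1.154 := by
  have hz2 : z ^ 2 ≤ 1.3318 := (pow_le_pow_left₀ hz0 hz' 2).trans (by norm_num)
  have hv0 : 0 ≤ v := by
    by_contra h
    nlinarith
  have hv1 : v ≤ 1.154 := by nlinarith
  have h3 : z ^ 2 * v ≤ 1.3318 * 1.154 := mul_le_mul hz2 hv1 hv0 (by norm_num)
  exact ⟨hv0, by nlinarith, by norm_num, by norm_num⟩

theorem chordBound_root {x z : ℝ} (hx0 : 0 ≤ x) (hz0 : 0 ≤ z) (hz' : z ≤ 1.154)
    (hh : z - 1 ≤ x * z ^ 3) : ChordBound (10 * x) z 1 1.154 := by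
  have hz3 : z ^ 3 ≤ 1.537 := (pow_le_pow_left₀ hz0 hz' 3).trans (by norm_num)
  exact ⟨hz0, by nlinarith, by norm_num, by norm_num⟩

/-- At the end x = 0 of the chords η, β, γ are 1 and σ₅ is 2, which makes the bracket in `hY` equal
to 12. At x = 1/10 it is at most 71, and division by 1 - x σ₁ brings this to at most 71 * 1.63 <
116. The chord from 12 to 116 has slope 1040 in x. -/
theorem chordBound_tail {x z v : ℝ} (hx0 : 0 ≤ x) (hx1 : x ≤ 1 / 10)
    (Z : ChordBound (10 * x) z 1 1.154) (V : ChordBound (10 * x) v 1 1.154)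
    {η β γ σ₁ σ₂ σ₃ σ₄ σ₅ ω₂ ω₃ ω₄ Y : ℝ} (hη : η = z * z * z) (hβ : β = z * z * z * v)
    (hγ : γ = z * z * z * v * (z * z))
    (hσ₅ : σ₅ = (z * z * z * v + z * z * z * v) * (z * z * (z * z)) * v)
    (hσ₄ : σ₄ = γ + x * σ₅) (hσ₃ : σ₃ = γ + σ₄) (hσ₂ : σ₂ = β + x * σ₃)
    (hσ₁ : σ₁ = η + σ₂) (hω₂ : ω₂ = x * η * η + β) (hω₃ : ω₃ = η * ω₂ + β * η + γ)
    (hω₄ : ω₄ = x * η * ω₃ + β * ω₂ + x * γ * η + γ)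
    (hY : Y * (1 - x * σ₁) ≤ x ^ 3 * (σ₁ * ω₄ + σ₂ * ω₃ + σ₃ * ω₂ + σ₄ * η + σ₅)) :
    Y ≤ x ^ 3 * (12 + 1040 * x) := by
  have t0 : 0 ≤ 10 * x := by linarith
  have t1 : 10 * x ≤ 1 := by linarith
  have X : ChordBound (10 * x) x 0 (1 / 10) := ⟨hx0, by linarith, le_rfl, by norm_num⟩
  have R := Z.mul t0 t1 Z
  have HH := R.mul t0 t1 Z
  have B := HH.mul t0 t1 V
  have S5 := ((B.add B).mul t0 t1 (R.mul t0 t1 R)).mul t0 t1 V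
  have BR := B.mul t0 t1 R
  rw [← hη] at HH
  rw [← hβ] at B
  rw [← hγ] at BR
  rw [← hσ₅] at S5
  have S4 := BR.add (X.mul t0 t1 S5)
  rw [← hσ₄] at S4
  have S3 := BR.add S4
  rw [← hσ₃] at S3
  have S2 := B.add (X.mul t0 t1 S3)
  rw [← hσ₂] at S2
  have S1 := HH.add S2
  rw [← hσ₁] at S1
  have W2 := ((X.mul t0 t1 HH).mul t0 t1 HH).add B
  rw [← hω₂] at W2
  have W3 := ((HH.mul t0 t1 W2).add (B.mul t0 t1 HH)).add BR
  rw [← hω₃] at W3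
  have W4 := ((((X.mul t0 t1 HH).mul t0 t1 W3).add (B.mul t0 t1 W2)).add
    ((X.mul t0 t1 BR).mul t0 t1 HH)).add BR
  rw [← hω₄] at W4
  have T := ((((S1.mul t0 t1 W4).add (S2.mul t0 t1 W3)).add (S3.mul t0 t1 W2)).add
    (S4.mul t0 t1 HH)).add S5
  clear hη hβ hγ hσ₁ hσ₂ hσ₃ hσ₄ hσ₅ hω₂ hω₃ hω₄
  generalize σ₁ * ω₄ + σ₂ * ω₃ + σ₃ * ω₂ + σ₄ * η + σ₅ = τ at *
  have hσ1le : σ₁ ≤ 3.86 := (S1.le_right t1).trans (by norm_num)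
  have hσ0 := S1.nonneg
  have hxσ : x * σ₁ ≤ 0.1 * 3.86 := mul_le_mul (by linarith) hσ1le hσ0 (by norm_num)
  have T' : ChordBound (10 * x) τ 12 71 := T.weaken t0 t1 (by norm_num) (by norm_num) (by norm_num)
  clear T W4 W3 W2 S1 S2 S3 S4 S5 BR B HH R X
  obtain ⟨v', hv'⟩ : ∃ v', v' = 1 / (1 - x * σ₁) := ⟨_, rfl⟩
  have hvinv' : v' * (1 - x * σ₁) = 1 := by rw [hv']; exact one_div_mul_cancel (by linarith)
  have hv0' : 0 ≤ v' := by rw [hv']; exact one_div_nonneg.2 (by linarith)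
  have V' : ChordBound (10 * x) v' 1 1.63 := by
    have h2 : v' ≤ 1.629 := by nlinarith
    have h3 : σ₁ * v' ≤ 3.86 * 1.629 := mul_le_mul hσ1le h2 hv0' (by norm_num)
    exact ⟨hv0', by nlinarith, by norm_num, by norm_num⟩
  have F : ChordBound (10 * x) (τ * v') 12 116 :=
    (T'.mul t0 t1 V').weaken t0 t1 (by norm_num) (by norm_num) (by norm_num)
  have hfin := mul_le_mul_of_nonneg_right hY hv0'
  rw [mul_assoc, mul_comm _ v', hvinv', mul_one] at hfin
  refine hfin.trans ?_
  rw [mul_assoc]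
  refine mul_le_mul_of_nonneg_left ?_ (pow_nonneg hx0 3)
  linarith [F.le]

namespace OneDepSeq

variable {p q : ℕ → ℝ}

theorem sum_abs_partialC_le (H : OneDepSeq p q) {z : ℝ} (hz : 1 ≤ z) (hz' : z ≤ 1.154)
    (hroot : ∑' k, (-1) ^ k * (p k * z ^ (k + 1)) = 1) (M : ℕ) :
    ∑ i ∈ Finset.range M, |partialC p z (i + 4 + 1)| ≤
      2 * (z * (p 1 * z ^ 2) / (1 - p 1 * z ^ 2)) * (p 1 * z ^ 2) ^ 2 / (1 - p 1 * z ^ 2) := by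
  have hz0 : 0 ≤ z := by linarith
  have hr := H.ratio_le hz0 hz'
  have hr0 := H.ratio_nonneg z
  set r := p 1 * z ^ 2 with hrdef
  have hb : 0 ≤ z * r / (1 - r) := div_nonneg (mul_nonneg hz0 hr0) (by linarith)
  have h := sum_range_le_of_two_step (r := r) (by linarith) M
    (fun i => z * r / (1 - r) * r ^ ((i + 4) / 2))
    (fun i => mul_nonneg hb (pow_nonneg hr0 _)) (fun i => by
      rw [show (i + 2 + 4) / 2 = (i + 4) / 2 + 1 by omega, pow_succ]
      exact le_of_eq (by ring))
  refine (Finset.sum_le_sum fun i _ => H.abs_partialC_le hz hz' hroot (i + 4)).trans (h.trans ?_)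
  norm_num
  exact le_of_eq (by ring)

/-- Bound of the tail of `∑ incr q z k`. -/
theorem sum_incr_tail_le (H : OneDepSeq p q) {z : ℝ} (hz : 1 ≤ z) (hz' : z ≤ 1.154)
    (hroot : ∑' k, (-1) ^ k * (p k * z ^ (k + 1)) = 1) (M : ℕ) :
    ∑ k ∈ Finset.range M, |incr q z (k + 5)| ≤ p 1 ^ 3 * (12 + 1040 * p 1) := by
  have hz0 : 0 ≤ z := by linarith
  have hr := H.ratio_le hz0 hz'
  have hh := H.root_sub_one_le hz hz' hroot
  have hU := H.abs_partialC_le hz hz' hroot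
  have hS5 := H.sum_abs_partialC_le hz hz' hroot
  have hp0 := H.p_nonneg 1
  have hu0 : |partialC p z (0 + 1)| ≤ p 1 * (z * z * z) := by
    have : partialC p z (0 + 1) = -(z - 1) := by simp [partialC, H.p_zero]
    rw [this, abs_neg, abs_of_nonneg (by linarith)]
    exact hh.trans (le_of_eq (by ring))
  obtain ⟨v, hv⟩ : ∃ v, v = 1 / (1 - p 1 * z ^ 2) := ⟨_, rfl⟩
  have hvinv : v * (1 - p 1 * z ^ 2) = 1 := by rw [hv]; exact one_div_mul_cancel (by linarith)
  have hdiv : ∀ y, y / (1 - p 1 * z ^ 2) = y * v := fun y => by rw [hv]; ring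
  simp only [hdiv] at hU hS5
  have V := chordBound_inv hp0 hz0 hz' hr hvinv
  have hv0 := V.nonneg
  refine chordBound_tail hp0 H.p_one (chordBound_root hp0 hz0 hz' hh) V
    rfl rfl rfl rfl rfl rfl rfl rfl rfl rfl rfl ?_
  refine renewal_tail_le_pow (u := fun i => partialC p z (i + 1)) rfl (H.incr_succ z) hp0
    (by positivity) (by positivity) (by positivity) (by positivity) rfl rfl rfl rfl rfl rfl rfl
    hu0 ((hU 1).trans (le_of_eq ?_)) ((hU 2).trans (le_of_eq ?_)) ((hU 3).trans (le_of_eq ?_))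
    (fun M => (hS5 M).trans (le_of_eq ?_)) M
  · norm_num; ring
  · norm_num; ring
  · norm_num; ring
  · ring

end OneDepSeq

theorem abs_mul_le_mul {a b c d : ℝ} (ha : |a| ≤ c) (hb : |b| ≤ d) : |a * b| ≤ c * d := by
  rw [abs_mul]
  exact mul_le_mul ha hb (abs_nonneg b) ((abs_nonneg a).trans ha)

/-! ### Expansion of the root to second order. -/

/-- Putting z = 1 + h into C(z) = 0 gives an equation for h with linear part x - s. All other terms
are of second order, because h = O(x) and c₃, c₄ ≤ x^2. -/
theorem root_first_order {x s c₃ c₄ z h η β U R : ℝ} (hx0 : 0 ≤ x)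
    (hs0 : 0 ≤ s) (hsx : s ≤ x) (h30 : 0 ≤ c₃) (h3 : c₃ ≤ x ^ 2) (h40 : 0 ≤ c₄) (h43 : c₄ ≤ c₃)
    (hzh : z = 1 + h) (hh0 : 0 ≤ h) (hh1 : h ≤ 0.154) (hhη : h ≤ x * η) (hη0 : 0 ≤ η)
    (heq : h = x * z ^ 2 - s * z ^ 3 + c₃ * z ^ 4 - c₄ * z ^ 5 + R)
    (hR : |R| ≤ x ^ 3 * β) (hU : U = η * (2 + x * η) + z ^ 4 + x * β) :
    |h - (x - s)| ≤ x ^ 2 * U := by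
  have hR' := abs_le.1 hR
  have hz0 : 0 ≤ z := by linarith
  have hg : x * h * (2 + h) ≤ x ^ 2 * (η * (2 + x * η)) := by
    have h1 : h * (2 + h) ≤ x * η * (2 + x * η) :=
      mul_le_mul hhη (by linarith) (by linarith) (mul_nonneg hx0 hη0)
    calc x * h * (2 + h) = x * (h * (2 + h)) := by ring
      _ ≤ x * (x * η * (2 + x * η)) := mul_le_mul_of_nonneg_left h1 hx0
      _ = _ := by ring
  have hz4 : 0 ≤ z ^ 4 := by positivity
  have hc3 : c₃ * z ^ 4 ≤ x ^ 2 * z ^ 4 := mul_le_mul_of_nonneg_right h3 hz4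
  have hc4 : c₄ * z ^ 5 ≤ c₃ * z ^ 5 := mul_le_mul_of_nonneg_right h43 (by positivity)
  have hc40 : 0 ≤ c₄ * z ^ 5 := by positivity
  have hc30 : 0 ≤ c₃ * z ^ 4 := by positivity
  have hUx : x ^ 2 * U = x ^ 2 * (η * (2 + x * η)) + x ^ 2 * z ^ 4 + x ^ 3 * β := by
    rw [hU]; ring
  have hcub : 0 ≤ 3 * h + 3 * h ^ 2 + h ^ 3 := by positivity
  have hs1 := mul_le_mul_of_nonneg_right hsx hcub
  have hs2 := mul_nonneg hs0 hcub
  have a1 : x * (h + 2 * h ^ 2 + h ^ 3) ≤ x * h * (2 + h) := by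
    have : 0 ≤ x * h * (1 - h - h ^ 2) := mul_nonneg (mul_nonneg hx0 hh0) (by nlinarith)
    linarith
  have a2 : c₃ * z ^ 4 * h ≤ c₃ * z ^ 4 * 1 :=
    mul_le_mul_of_nonneg_left (by linarith) hc30
  have a3 : c₃ * z ^ 5 = c₃ * z ^ 4 + c₃ * z ^ 4 * h := by rw [hzh]; ring
  have hE : h - (x - s) = x * h * (2 + h) - s * (3 * h + 3 * h ^ 2 + h ^ 3)
      + c₃ * z ^ 4 - c₄ * z ^ 5 + R := by
    have b1 : x * z ^ 2 = x + x * h * (2 + h) := by rw [hzh]; ring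
    have b2 : s * z ^ 3 = s + s * (3 * h + 3 * h ^ 2 + h ^ 3) := by rw [hzh]; ring
    rw [b1, b2] at heq
    linarith
  have a4 : x * (3 * h + 3 * h ^ 2 + h ^ 3)
      = x * h * (2 + h) + x * (h + 2 * h ^ 2 + h ^ 3) := by ring
  rw [hE, hUx, abs_le]
  clear hE hUx heq hU
  generalize c₃ * z ^ 4 * h = m1 at *
  generalize c₃ * z ^ 4 = m2 at *
  generalize c₄ * z ^ 5 = m3 at *
  generalize c₃ * z ^ 5 = m3' at *
  generalize x * h * (2 + h) = m4 at *
  generalize x * (h + 2 * h ^ 2 + h ^ 3) = m5 at *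
  generalize x * (3 * h + 3 * h ^ 2 + h ^ 3) = m6 at *
  generalize s * (3 * h + 3 * h ^ 2 + h ^ 3) = m7 at *
  generalize x ^ 2 * (η * (2 + x * η)) = m8 at *
  generalize x ^ 2 * z ^ 4 = m9 at *
  constructor <;> linarith

/-- The first order approximation is fed back into the term (2x - 3s) h of the equation for h; what
is left over is of third order. -/
theorem root_second_order {x s c₃ c₄ z h η β U R : ℝ} (hx0 : 0 ≤ x)
    (hs0 : 0 ≤ s) (hsx : s ≤ x) (h30 : 0 ≤ c₃) (h3 : c₃ ≤ x ^ 2) (h40 : 0 ≤ c₄) (h43 : c₄ ≤ c₃)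
    (hzh : z = 1 + h) (hh0 : 0 ≤ h) (hh1 : h ≤ 0.154) (hhη : h ≤ x * η) (hη0 : 0 ≤ η)
    (hη1 : η ≤ 1.537)
    (heq : h = x * z ^ 2 - s * z ^ 3 + c₃ * z ^ 4 - c₄ * z ^ 5 + R)
    (hR : |R| ≤ x ^ 3 * β) (hE : |h - (x - s)| ≤ x ^ 2 * U) :
    |h - ((x - s) + ((2 * x - 3 * s) * (x - s) + (c₃ - c₄)))| ≤
      x ^ 3 * (2 * U + η * η + η * ((1 + z) * (1 + z ^ 2)) + β) := by
  have hR' := abs_le.1 hR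
  have hz0 : 0 ≤ z := by linarith
  have hz : 1 ≤ z := by linarith
  have hK : h - ((x - s) + ((2 * x - 3 * s) * (x - s) + (c₃ - c₄)))
      = (2 * x - 3 * s) * (h - (x - s)) + (x * h ^ 2 - s * (3 * h ^ 2 + h ^ 3))
        + (c₃ * (z ^ 4 - 1) - c₄ * (z ^ 5 - 1)) + R := by
    have b1 : x * z ^ 2 = x + 2 * x * h + x * h ^ 2 := by rw [hzh]; ring
    have b2 : s * z ^ 3 = s + 3 * s * h + s * (3 * h ^ 2 + h ^ 3) := by rw [hzh]; ring
    rw [b1, b2] at heq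
    linarith
  have b1 := abs_le.1 (abs_mul_le_mul (a := 2 * x - 3 * s) (c := 2 * x)
    (abs_le.2 ⟨by linarith, by linarith⟩) hE)
  have hq0 : 0 ≤ 3 * h ^ 2 + h ^ 3 := by positivity
  have b2 := mul_le_mul_of_nonneg_right hsx hq0
  have b3 := mul_nonneg hs0 hq0
  have b4 : x * h ^ 2 ≤ x ^ 3 * (η * η) := by
    have : h * h ≤ x * η * (x * η) := mul_le_mul hhη hhη hh0 (mul_nonneg hx0 hη0)
    calc x * h ^ 2 = x * (h * h) := by ring
      _ ≤ x * (x * η * (x * η)) := mul_le_mul_of_nonneg_left this hx0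
      _ = _ := by ring
  have hm0 : 0 ≤ z ^ 4 - 1 := sub_nonneg.2 (one_le_pow₀ hz)
  have hm1 : 0 ≤ z ^ 5 - 1 := sub_nonneg.2 (one_le_pow₀ hz)
  have b5 := mul_le_mul_of_nonneg_right h3 hm0
  have b6 := mul_le_mul_of_nonneg_right h43 hm1
  have b7 := mul_nonneg h40 hm1
  have b7' := mul_nonneg h30 hm0
  have b8 : x ^ 2 * (z ^ 4 - 1) ≤ x ^ 3 * (η * ((1 + z) * (1 + z ^ 2))) := by
    have hf : 0 ≤ x ^ 2 * ((1 + z) * (1 + z ^ 2)) := by positivity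
    calc x ^ 2 * (z ^ 4 - 1) = h * (x ^ 2 * ((1 + z) * (1 + z ^ 2))) := by rw [hzh]; ring
      _ ≤ x * η * (x ^ 2 * ((1 + z) * (1 + z ^ 2))) := mul_le_mul_of_nonneg_right hhη hf
      _ = _ := by ring
  -- Apart from the linear term and R, the error is at least minus the left side, and at most the
  -- right side. Hence one budget serves for both signs.
  have b9 : x * (2 * h ^ 2 + h ^ 3) + x ^ 2 * (z ^ 4 * h)
      ≤ x * h ^ 2 + x ^ 2 * (z ^ 4 - 1) := by
    have hη2 : h * z ≤ x * 1.774 := by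
      have h2 : η * z ≤ 1.774 :=
        (mul_le_mul hη1 (by linarith : z ≤ 1.154) (by linarith) (by norm_num)).trans
          (by norm_num)
      calc h * z ≤ x * η * z := mul_le_mul_of_nonneg_right hhη hz0
        _ = x * (η * z) := by ring
        _ ≤ _ := mul_le_mul_of_nonneg_left h2 hx0
    have hh4 : z ^ 4 ≤ 1.774 :=
      (pow_le_pow_left₀ hz0 (by linarith : z ≤ 1.154) 4).trans (by norm_num)
    have c1 : x * h * (h * z) ≤ x * h * (x * 1.774) :=
      mul_le_mul_of_nonneg_left hη2 (mul_nonneg hx0 hh0)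
    have c2 : x ^ 2 * h * z ^ 4 ≤ x ^ 2 * h * 1.774 :=
      mul_le_mul_of_nonneg_left hh4 (mul_nonneg (sq_nonneg x) hh0)
    have c3 : x ^ 2 * (4 * h) ≤ x ^ 2 * (z ^ 4 - 1) :=
      mul_le_mul_of_nonneg_left (by
        have := one_add_mul_le_pow (by linarith : -2 ≤ h) 4
        rw [hzh]; norm_num at this; linarith) (sq_nonneg x)
    have c4 : 0 ≤ x ^ 2 * h := by positivity
    have c5 : x * h * (h * z) = x * (2 * h ^ 2 + h ^ 3) - x * h ^ 2 := by rw [hzh]; ring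
    have c6 : x * h * (x * 1.774) = 1.774 * (x ^ 2 * h) := by ring
    have c7 : x ^ 2 * h * z ^ 4 = x ^ 2 * (z ^ 4 * h) := by ring
    linarith
  have b10 : c₃ * (z ^ 4 * h) ≤ x ^ 2 * (z ^ 4 * h) :=
    mul_le_mul_of_nonneg_right h3 (by positivity)
  have b11 : x * (3 * h ^ 2 + h ^ 3) = x * (2 * h ^ 2 + h ^ 3) + x * h ^ 2 := by ring
  have b12 : c₃ * (z ^ 5 - 1) = c₃ * (z ^ 4 - 1) + c₃ * (z ^ 4 * h) := by rw [hzh]; ring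
  have b13 : x ^ 3 * (2 * U + η * η + η * ((1 + z) * (1 + z ^ 2)) + β)
      = 2 * x * (x ^ 2 * U) + x ^ 3 * (η * η) + x ^ 3 * (η * ((1 + z) * (1 + z ^ 2)))
        + x ^ 3 * β := by ring
  have b14 : 0 ≤ x * h ^ 2 := by positivity
  rw [hK, b13, abs_le]
  clear hK b13 heq hq0 hm0 hm1 hhη hE hR
  generalize (2 * x - 3 * s) * (h - (x - s)) = m1 at *
  generalize 2 * x * (x ^ 2 * U) = m2 at *
  generalize s * (3 * h ^ 2 + h ^ 3) = m3 at *
  generalize x * (3 * h ^ 2 + h ^ 3) = m4 at *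
  generalize x * (2 * h ^ 2 + h ^ 3) = m5 at *
  generalize x * h ^ 2 = m6 at *
  generalize c₃ * (z ^ 4 - 1) = m7 at *
  generalize c₄ * (z ^ 5 - 1) = m8 at *
  generalize c₃ * (z ^ 5 - 1) = m9 at *
  generalize c₃ * (z ^ 4 * h) = m10 at *
  generalize x ^ 2 * (z ^ 4 * h) = m11 at *
  generalize x ^ 2 * (z ^ 4 - 1) = m12 at *
  generalize x ^ 3 * (η * η) = m13 at *
  generalize x ^ 3 * (η * ((1 + z) * (1 + z ^ 2))) = m14 at *
  generalize x ^ 3 * β = m15 at *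
  constructor <;> linarith

/-- Second order approximation of the root, with its first order part. -/
theorem root_approx {x s c₃ c₄ z v R : ℝ} (hx0 : 0 ≤ x) (hx1 : x ≤ 1 / 10) (hs0 : 0 ≤ s)
    (hsx : s ≤ x) (h30 : 0 ≤ c₃) (h3 : c₃ ≤ x ^ 2) (h40 : 0 ≤ c₄) (h43 : c₄ ≤ c₃)
    (hz : 1 ≤ z) (hz' : z ≤ 1.154) (hh : z - 1 ≤ x * z ^ 3)
    (Z : ChordBound (10 * x) z 1 1.154) (V : ChordBound (10 * x) v 1 1.154)
    (heq : z - 1 = x * z ^ 2 - s * z ^ 3 + c₃ * z ^ 4 - c₄ * z ^ 5 + R)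
    (hR : |R| ≤ x ^ 3 * (z * z * z * v * (z * z) * (z * z))) :
    z ≤ 1 + (x - s) + 0.541 * x ∧
    |z - (1 + ((x - s) + ((2 * x - 3 * s) * (x - s) + (c₃ - c₄))))| ≤ x ^ 3 * (12 + 122 * x) := by
  have t0 : 0 ≤ 10 * x := by linarith
  have t1 : 10 * x ≤ 1 := by linarith
  have X : ChordBound (10 * x) x 0 (1 / 10) := ⟨hx0, by linarith, le_rfl, by norm_num⟩
  have One : ChordBound (10 * x) 1 1 1 := ⟨zero_le_one, by simp, zero_le_one, le_rfl⟩
  have ZZ := Z.mul t0 t1 Z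
  have Hη := ZZ.mul t0 t1 Z
  have Hβ := ((Hη.mul t0 t1 V).mul t0 t1 ZZ).mul t0 t1 ZZ
  replace Hβ := Hβ.weaken t0 t1 (c := 1) (d := 3.1464) (by norm_num) (by norm_num) (by norm_num)
  replace ZZ := ZZ.weaken t0 t1 (c := 1) (d := 1.33172) (by norm_num) (by norm_num) (by norm_num)
  replace Hη := Hη.weaken t0 t1 (c := 1) (d := 1.537) (by norm_num) (by norm_num) (by norm_num)
  have HU := ((Hη.mul t0 t1 ((One.add One).add (X.mul t0 t1 Hη))).add (ZZ.mul t0 t1 ZZ)).add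
    (X.mul t0 t1 Hβ)
  replace HU := HU.weaken t0 t1 (c := 3) (d := 5.4) (by norm_num) (by norm_num) (by norm_num)
  have HK := (((HU.add HU).add (Hη.mul t0 t1 Hη)).add
    (Hη.mul t0 t1 ((One.add Z).mul t0 t1 (One.add ZZ)))).add Hβ
  -- The left end 12 is exact, since there U = 3 and the sum is 6 + 1 + 4 + 1. The slope in x is 10
  -- * (24.2 - 12) = 122.
  replace HK := HK.weaken t0 t1 (c := 12) (d := 24.2) (by norm_num) (by norm_num) (by norm_num)
  have hhη : z - 1 ≤ x * (z * z * z) := hh.trans (le_of_eq (by ring))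
  have h1 := root_first_order hx0 hs0 hsx h30 h3 h40 h43 (by ring) (sub_nonneg.2 hz)
    (by linarith) hhη Hη.nonneg heq hR rfl
  have h2 := root_second_order hx0 hs0 hsx h30 h3 h40 h43 (by ring) (sub_nonneg.2 hz)
    (by linarith) hhη Hη.nonneg (Hη.le_right t1) heq hR h1
  have e : z * z * z * (2 + x * (z * z * z)) + z ^ 4
        + x * (z * z * z * v * (z * z) * (z * z))
      = z * z * z * (1 + 1 + x * (z * z * z)) + z * z * (z * z)
        + x * (z * z * z * v * (z * z) * (z * z)) := by ring
  rw [e] at h1 h2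
  have hHU := HU.nonneg
  have hHU' := HU.le_right t1
  have hHK := HK.le
  clear HU HK Hβ Hη ZZ X One V Z e hh heq hR
  generalize z * z * z * v * (z * z) * (z * z) = β at *
  generalize hU : z * z * z * (1 + 1 + x * (z * z * z)) + z * z * (z * z) + x * β = U at *
  constructor
  · have h3 : x * U ≤ 1 / 10 * 5.4 := mul_le_mul hx1 hHU' hHU (by norm_num)
    have h4 := mul_le_mul_of_nonneg_left h3 hx0
    have h5 := (abs_le.1 h1).2
    have h6 : x ^ 2 * U = x * (x * U) := by ring
    linarith
  · have e1 : z - (1 + ((x - s) + ((2 * x - 3 * s) * (x - s) + (c₃ - c₄))))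
      = z - 1 - ((x - s) + ((2 * x - 3 * s) * (x - s) + (c₃ - c₄))) := by ring
    rw [e1]
    refine h2.trans (mul_le_mul_of_nonneg_left ?_ (pow_nonneg hx0 3))
    rw [sq z, two_mul]
    linarith

/-! ### Numerator, inverse powers and the explicit approximation. -/

theorem numerator_bounds {x s c₃ c₄ : ℝ} (hx1 : x ≤ 1 / 10) (hs0 : 0 ≤ s)
    (hsx : s ≤ x) (h3 : c₃ ≤ x ^ 2) (h3s : c₃ ≤ s) (h40 : 0 ≤ c₄) (h43 : c₄ ≤ c₃) :
    |1 - s + x ^ 2 - 6 * x * s + 6 * s ^ 2 + 2 * c₃ - 3 * c₄| ≤ 1 + 2 * x ^ 2 := by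
  have h1 := mul_nonneg hs0 (sub_nonneg.2 hsx)
  have h2 : s * x ≤ 1 / 10 * (1 / 10) :=
    mul_le_mul (hsx.trans hx1) hx1 (by linarith) (by norm_num)
  rw [abs_le]
  constructor <;> nlinarith

/-- `(z² + zμ + μ²) q₃` is not much larger than `3`. -/
theorem sq_mul_le {x d m w y : ℝ} (hx0 : 0 ≤ x) (hx1 : x ≤ 1 / 10) (hd0 : 0 ≤ d) (hdx : d ≤ x)
    (hm0 : 0 ≤ m) (hm : m ≤ 1 + 1.2 * d + 0.541 * x) (hw0 : 0 ≤ w)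
    (hw : w ≤ 1 + 1.2 * d + 0.541 * x) (hy0 : 0 ≤ y) (hy : y ≤ 1 - 2 * d - 0.9 * x) :
    (m ^ 2 + m * w + w ^ 2) * y ≤ 3.13 := by
  have hb0 : 0 ≤ 1 + 1.2 * d + 0.541 * x := by positivity
  have h1 := mul_le_mul hm hm hm0 hb0
  have h2 := mul_le_mul hm hw hw0 hb0
  have h3 := mul_le_mul hw hw hw0 hb0
  have h4 : m ^ 2 + m * w + w ^ 2 ≤ 3 * ((1 + 1.2 * d + 0.541 * x) * (1 + 1.2 * d + 0.541 * x)) := by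
    linarith
  -- The decrease of `y` offsets the growth of the squares: to first order the product is 3 (1 + 0.4
  -- d + 0.182 x), and the negative second order terms bring it below 3.13.
  have h5 := mul_le_mul h4 hy hy0 (by positivity)
  refine h5.trans ?_
  have e1 := mul_nonneg hd0 hx0
  have e2 := mul_nonneg hd0 (sub_nonneg.2 hx1)
  have e3 := mul_nonneg hx0 (sub_nonneg.2 hx1)
  have e4 := mul_nonneg hd0 hd0
  have e5 : 0 ≤ d * x * x := mul_nonneg e1 hx0
  have e6 : 0 ≤ d * d * x := mul_nonneg e4 hx0
  have e7 : 0 ≤ d * d * d := mul_nonneg e4 hd0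
  have e8 : 0 ≤ x * x * x := mul_nonneg (mul_nonneg hx0 hx0) hx0
  have e9 : 0 ≤ (x - d) * (1 / 10 - x) := mul_nonneg (sub_nonneg.2 hdx) (sub_nonneg.2 hx1)
  nlinarith

theorem cube_expansion {x d ε g : ℝ} (hx0 : 0 ≤ x) (hx1 : x ≤ 1 / 10) (hd0 : 0 ≤ d)
    (hdx : d ≤ x) (hε : |ε| ≤ 3 * x ^ 2) (hg0 : 0 ≤ g) (hg : g ≤ x ^ 2) :
    |(1 + (d + ε)) ^ 3 * (1 - (x + 2 * d) + g)
      - (1 + 3 * d + 3 * ε + 3 * d ^ 2 - (x + 2 * d) + g - 3 * d * (x + 2 * d))|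
      ≤ x ^ 3 * (17 + 122 * x) := by
  have hd : |d| ≤ x := by rwa [abs_of_nonneg hd0]
  have hg' : |g| ≤ x ^ 2 := by rwa [abs_of_nonneg hg0]
  have he : |x + 2 * d| ≤ 3 * x := by rw [abs_of_nonneg (by positivity)]; linarith
  have hεb := abs_le.1 hε
  have hθ : |d + ε| ≤ 1.3 * x := by
    refine (abs_add_le _ _).trans ?_
    nlinarith
  have heg : |x + 2 * d - g| ≤ 3 * x := by
    rw [abs_le]; constructor <;> nlinarith
  have m1 := abs_le.1 (abs_mul_le_mul hε hε)
  have m2 := abs_le.1 (abs_mul_le_mul (abs_mul_le_mul hd hd) hε)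
  have m3 := abs_le.1 (abs_mul_le_mul (abs_mul_le_mul hd hε) hε)
  have m4 := abs_le.1 (abs_mul_le_mul (abs_mul_le_mul hε hε) hε)
  have m5 := abs_le.1 (abs_mul_le_mul (abs_mul_le_mul hd hε) he)
  have m6 := abs_le.1 (abs_mul_le_mul (abs_mul_le_mul hε hε) he)
  have m7 := abs_le.1 (abs_mul_le_mul hε hg')
  have m8 := abs_le.1 (abs_mul_le_mul (abs_mul_le_mul hθ hθ) hg')
  have m9 := abs_le.1 (abs_mul_le_mul (abs_mul_le_mul (abs_mul_le_mul hθ hθ) hθ) heg)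
  have x4 : 0 ≤ x ^ 4 := pow_nonneg hx0 4
  have x5 : x ^ 5 ≤ x ^ 4 / 10 := by
    have := mul_le_mul_of_nonneg_left hx1 x4
    rw [pow_succ]; linarith
  have x6 : x ^ 6 ≤ x ^ 5 / 10 := by
    have := mul_le_mul_of_nonneg_left hx1 (pow_nonneg hx0 5)
    rw [pow_succ]; linarith
  have k1 : |ε * x| ≤ 3 * x ^ 2 * x := abs_mul_le_mul hε (le_of_eq (abs_of_nonneg hx0))
  have k1' := abs_le.1 k1
  have k2 : d * d ≤ x * x := mul_le_mul hdx hdx hd0 hx0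
  have k3 : d * d * d ≤ x * x * x := mul_le_mul k2 hdx hd0 (by positivity)
  have k4 : d * d * x ≤ x * x * x := mul_le_mul_of_nonneg_right k2 hx0
  have k5 : d * g ≤ x * x ^ 2 := mul_le_mul hdx hg hg0 hx0
  have k6 : 0 ≤ d * g := mul_nonneg hd0 hg0
  have k7 : 0 ≤ d * d * d := by positivity
  have k8 : 0 ≤ d * d * x := by positivity
  -- The first bracket holds the third order terms: 3 * 3 from ε x, then 5 + 3 from the two cubic
  -- terms in d and x, while the term in d g has the opposite sign; together at most 17 x^3. The
  -- second bracket is of fourth order or higher and is covered by 122 x^4.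
  have hexp : (1 + (d + ε)) ^ 3 * (1 - (x + 2 * d) + g)
      - (1 + 3 * d + 3 * ε + 3 * d ^ 2 - (x + 2 * d) + g - 3 * d * (x + 2 * d))
      = (-3 * (ε * x) - 5 * (d * d * d) - 3 * (d * d * x) + 3 * (d * g))
        + (3 * (ε * ε) + 3 * (d * d * ε) + 3 * (d * ε * ε) + ε * ε * ε
          - 6 * (d * ε * (x + 2 * d)) - 3 * (ε * ε * (x + 2 * d)) + 3 * (ε * g)
          + 3 * ((d + ε) * (d + ε) * g) - (d + ε) * (d + ε) * (d + ε) * (x + 2 * d - g)) := by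
    ring
  rw [hexp, abs_le]
  constructor <;> ring_nf at m1 m2 m3 m4 m5 m6 m7 m8 m9 k1' k2 k3 k4 k5 k6 k7 k8 ⊢ <;> linarith

theorem abs_inv_pow_sub_inv_pow_le {a b : ℝ} (ha : 1 ≤ a) (hb : 1 ≤ b) (n : ℕ) :
    |1 / a ^ n - 1 / b ^ n| ≤ n * |a - b| := by
  have ha0 : 0 < a := by linarith
  have hb0 : 0 < b := by linarith
  have h := abs_pow_sub_pow_le a⁻¹ b⁻¹ n
  have ha1 : a⁻¹ ≤ 1 := inv_le_one_of_one_le₀ ha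
  have hb1 : b⁻¹ ≤ 1 := inv_le_one_of_one_le₀ hb
  have h2 : max |a⁻¹| |b⁻¹| ^ (n - 1) ≤ 1 := by
    refine pow_le_one₀ (le_max_of_le_left (abs_nonneg _)) (max_le ?_ ?_)
    · rwa [abs_of_pos (inv_pos.2 ha0)]
    · rwa [abs_of_pos (inv_pos.2 hb0)]
  have h3 : |a⁻¹ - b⁻¹| ≤ |a - b| := by
    rw [inv_sub_inv ha0.ne' hb0.ne', abs_div, abs_sub_comm b a]
    refine div_le_self (abs_nonneg _) ?_
    rw [abs_of_pos (mul_pos ha0 hb0)]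
    nlinarith
  rw [one_div, one_div, ← inv_pow, ← inv_pow]
  calc _ ≤ _ := h
    _ ≤ |a⁻¹ - b⁻¹| * n * 1 :=
      mul_le_mul_of_nonneg_left h2 (mul_nonneg (abs_nonneg _) (Nat.cast_nonneg n))
    _ ≤ _ := by rw [mul_one, mul_comm]; exact mul_le_mul_of_nonneg_left h3 (Nat.cast_nonneg n)

namespace OneDepSeq

variable {p q : ℕ → ℝ}

theorem q_zero (H : OneDepSeq p q) : q 0 = 1 := by
  have := H.conv 0
  simp [Finset.Nat.sum_antidiagonal_succ, signedCoeff, shiftedCoeff, H.p_zero] at this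
  linarith

theorem q_one (H : OneDepSeq p q) : q 1 = 1 - p 1 := by
  have := H.conv 1
  simp [Finset.Nat.sum_antidiagonal_succ, signedCoeff, shiftedCoeff, H.p_zero, H.q_zero] at this
  linarith

theorem q_two (H : OneDepSeq p q) : q 2 = 1 - 2 * p 1 + p 2 := by
  have := H.conv 2
  simp [Finset.Nat.sum_antidiagonal_succ, signedCoeff, shiftedCoeff, H.p_zero, H.q_zero,
    H.q_one] at this
  linarith

theorem q_three (H : OneDepSeq p q) : q 3 = 1 - 3 * p 1 + 2 * p 2 + p 1 ^ 2 - p 3 := by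
  have := H.conv 3
  simp [Finset.Nat.sum_antidiagonal_succ, signedCoeff, shiftedCoeff, H.p_zero, H.q_zero,
    H.q_one, H.q_two] at this
  linarith

theorem q_four (H : OneDepSeq p q) :
    q 4 = 1 - 4 * p 1 + 3 * p 2 + 3 * p 1 ^ 2 - 2 * p 1 * p 2 - 2 * p 3 + p 4 := by
  have := H.conv 4
  simp [Finset.Nat.sum_antidiagonal_succ, signedCoeff, shiftedCoeff, H.p_zero, H.q_zero,
    H.q_one, H.q_two, H.q_three] at this
  linarith

theorem pow_mul_q_sub_le (H : OneDepSeq p q) {z : ℝ} (hz : 1 ≤ z) (hz' : z ≤ 1.154)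
    (hroot : ∑' k, (-1) ^ k * (p k * z ^ (k + 1)) = 1) {n : ℕ} (hn : 3 ≤ n) :
    |z ^ n * q n - z ^ 3 * q 3| ≤ p 1 ^ 3 * (12 + 1040 * p 1) := by
  obtain ⟨m, rfl⟩ := Nat.exists_eq_add_of_le hn
  -- `shiftedCoeff` is off by one, so the increments sum to z^(n+1) q_n; the surplus factor z ≥ 1 is
  -- dropped at the end.
  have h1 := sum_incr q z (3 + m + 1)
  have h2 := sum_incr q z 4
  have h3 := H.sum_incr_tail_le hz hz' hroot m
  rw [show 3 + m + 1 + 1 = 5 + m by ring, Finset.sum_range_add, h2] at h1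
  have h4 : z * (z ^ (3 + m) * q (3 + m) - z ^ 3 * q 3)
      = ∑ k ∈ Finset.range m, incr q z (k + 5) := by
    simp only [shiftedCoeff, add_comm 5] at h1
    rw [eq_sub_of_add_eq' h1]
    ring
  have h5 := Finset.abs_sum_le_sum_abs (fun k => incr q z (k + 5)) (Finset.range m)
  rw [← h4, abs_mul, abs_of_nonneg (by linarith : 0 ≤ z)] at h5
  have h6 := mul_le_mul_of_nonneg_right hz (abs_nonneg (z ^ (3 + m) * q (3 + m) - z ^ 3 * q 3))
  linarith

/-- The approximation theorem with explicit constants. -/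
theorem approx (H : OneDepSeq p q) {n : ℕ} (hn : 3 ≤ n) :
    |q n - (6 * (q 1 - q 2) ^ 2 + 4 * q 3 - 3 * q 4) /
      (1 + q 1 - q 2 + q 3 - q 4 + 2 * q 1 ^ 2 + 3 * q 2 ^ 2 - 5 * q 1 * q 2) ^ n| ≤
      (105 + 1162 * p 1 + n * ((1 + 2 * p 1 ^ 2) * (12 + 122 * p 1))) * p 1 ^ 3 := by
  obtain ⟨z, hz, hz', hroot⟩ := H.exists_root
  have hz0 : 0 ≤ z := by linarith
  have hr := H.ratio_le hz0 hz'
  have hh := H.root_sub_one_le hz hz' hroot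
  have hx0 := H.p_nonneg 1
  have hx1 := H.p_one
  have htail := H.pow_mul_q_sub_le hz hz' hroot hn
  obtain ⟨v, hv⟩ : ∃ v, v = 1 / (1 - p 1 * z ^ 2) := ⟨_, rfl⟩
  have hvinv : v * (1 - p 1 * z ^ 2) = 1 := by rw [hv]; exact one_div_mul_cancel (by linarith)
  have V := chordBound_inv hx0 hz0 hz' hr hvinv
  have Z := chordBound_root hx0 hz0 hz' hh
  have hs0 := H.p_nonneg 2
  have hsx : p 2 ≤ p 1 := H.p_anti 1
  have h30 := H.p_nonneg 3
  have h3 : p 3 ≤ p 1 ^ 2 := by simpa using H.p_succ_le 2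
  have h3s : p 3 ≤ p 2 := H.p_anti 2
  have h40 := H.p_nonneg 4
  have h43 : p 4 ≤ p 3 := H.p_anti 3
  have hR : |(-partialC p z 5)| ≤ p 1 ^ 3 * (z * z * z * v * (z * z) * (z * z)) := by
    rw [abs_neg]
    refine (H.abs_partialC_le hz hz' hroot 4).trans (le_of_eq ?_)
    rw [hv]; norm_num; ring
  have heq : z - 1 = p 1 * z ^ 2 - p 2 * z ^ 3 + p 3 * z ^ 4 - p 4 * z ^ 5 + -partialC p z 5 := by
    simp only [partialC, Finset.sum_range_succ, Finset.sum_range_zero, H.p_zero]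
    ring
  obtain ⟨hz1, hκ⟩ := root_approx hx0 hx1 hs0 hsx h30 h3 h40 h43 hz hz' hh Z V heq hR
  have hN := numerator_bounds hx1 hs0 hsx h3 h3s h40 h43
  have hq30 := H.q_nonneg 3
  have hNe : 6 * (q 1 - q 2) ^ 2 + 4 * q 3 - 3 * q 4
      = 1 - p 2 + p 1 ^ 2 - 6 * p 1 * p 2 + 6 * p 2 ^ 2 + 2 * p 3 - 3 * p 4 := by
    rw [H.q_one, H.q_two, H.q_three, H.q_four]; ring
  have hμe : 1 + q 1 - q 2 + q 3 - q 4 + 2 * q 1 ^ 2 + 3 * q 2 ^ 2 - 5 * q 1 * q 2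
      = 1 + ((p 1 - p 2) + ((2 * p 1 - 3 * p 2) * (p 1 - p 2) + (p 3 - p 4))) := by
    rw [H.q_one, H.q_two, H.q_three, H.q_four]; ring
  have hq3 := H.q_three
  rw [hNe, hμe]
  clear hNe hμe heq hR V Z hvinv hv hroot hr hh
  generalize p 1 = x at *
  generalize p 2 = s at *
  generalize p 3 = c₃ at *
  generalize p 4 = c₄ at *
  generalize q 3 = y at *
  generalize q n = Q at *
  have hd0 : 0 ≤ x - s := by linarith
  have hx2 : x ^ 2 ≤ x / 10 := by nlinarith
  have hε1 : |(2 * x - 3 * s) * (x - s)| ≤ 2 * x * x :=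
    abs_mul_le_mul (abs_le.2 ⟨by linarith, by linarith⟩) (abs_le.2 ⟨by linarith, by linarith⟩)
  have hε1' := abs_le.1 hε1
  have hε : |(2 * x - 3 * s) * (x - s) + (c₃ - c₄)| ≤ 3 * x ^ 2 := by
    rw [abs_le]; constructor <;> nlinarith
  -- With d = x - s, the value q_3 is 1 - (x + 2 d) + (x^2 - c₃).
  have hcube := cube_expansion hx0 hx1 hd0 (by linarith) hε (g := x ^ 2 - c₃)
    (by linarith) (by linarith)
  have hm1 : (2 * x - 3 * s) * (x - s) ≤ 0.2 * (x - s) :=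
    mul_le_mul_of_nonneg_right (by linarith) hd0
  have hm2 : -0.1 * (x - s) ≤ (2 * x - 3 * s) * (x - s) :=
    mul_le_mul_of_nonneg_right (by linarith) hd0
  have hμ1 : 1 ≤ 1 + ((x - s) + ((2 * x - 3 * s) * (x - s) + (c₃ - c₄))) := by linarith
  have hμ2 : 1 + ((x - s) + ((2 * x - 3 * s) * (x - s) + (c₃ - c₄)))
      ≤ 1 + 1.2 * (x - s) + 0.541 * x := by linarith
  have hthree := sq_mul_le hx0 hx1 hd0 (by linarith) hz0 (by linarith) (by linarith) hμ2 hq30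
    (by linarith)
  -- The second order part of μ^3 q_3 is exactly the numerator of the theorem.
  have hpoly : (1 + ((x - s) + ((2 * x - 3 * s) * (x - s) + (c₃ - c₄)))) ^ 3
        * (1 - (x + 2 * (x - s)) + (x ^ 2 - c₃))
      - (1 + 3 * (x - s) + 3 * ((2 * x - 3 * s) * (x - s) + (c₃ - c₄)) + 3 * (x - s) ^ 2
        - (x + 2 * (x - s)) + (x ^ 2 - c₃) - 3 * (x - s) * (x + 2 * (x - s)))
      = (1 + ((x - s) + ((2 * x - 3 * s) * (x - s) + (c₃ - c₄)))) ^ 3 * y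
        - (1 - s + x ^ 2 - 6 * x * s + 6 * s ^ 2 + 2 * c₃ - 3 * c₄) := by
    rw [hq3]; ring
  rw [hpoly] at hcube
  clear hpoly hq3 hε hε1 hε1' hm1 hm2
  generalize 1 + ((x - s) + ((2 * x - 3 * s) * (x - s) + (c₃ - c₄))) = μ at *
  generalize 1 - s + x ^ 2 - 6 * x * s + 6 * s ^ 2 + 2 * c₃ - 3 * c₄ = N at *
  have hx3 : 0 ≤ x ^ 3 := pow_nonneg hx0 3
  have hκ' : |z - μ| ≤ x ^ 3 * 24.2 :=
    hκ.trans (mul_le_mul_of_nonneg_left (by linarith) hx3)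
  have hA : |z ^ 3 * y - μ ^ 3 * y| ≤ x ^ 3 * 24.2 * 3.13 := by
    have : z ^ 3 * y - μ ^ 3 * y = (z - μ) * ((z ^ 2 + z * μ + μ ^ 2) * y) := by ring
    rw [this]
    refine abs_mul_le_mul hκ' ?_
    rw [abs_of_nonneg (by positivity)]
    exact hthree
  -- The three differences contribute 12 + 1040 x, then 24.2 * 3.13 < 76, then 17 + 122 x.
  have hB : |z ^ n * Q - N| ≤ (105 + 1162 * x) * x ^ 3 := by
    have : z ^ n * Q - N = (z ^ n * Q - z ^ 3 * y) + (z ^ 3 * y - μ ^ 3 * y) + (μ ^ 3 * y - N) := by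
      ring
    rw [this]
    refine (abs_add_three _ _ _).trans ?_
    linarith
  have hzn : 1 ≤ z ^ n := one_le_pow₀ hz
  have hfin : Q - N / μ ^ n = (z ^ n * Q - N) * (1 / z ^ n) + N * (1 / z ^ n - 1 / μ ^ n) := by
    have : z ^ n ≠ 0 := by positivity
    field_simp
    ring
  have hC : |(z ^ n * Q - N) * (1 / z ^ n)| ≤ (105 + 1162 * x) * x ^ 3 * 1 := by
    refine abs_mul_le_mul hB ?_
    rw [abs_of_nonneg (by positivity)]
    exact (div_le_one (by positivity)).2 hzn
  have hD : |N * (1 / z ^ n - 1 / μ ^ n)|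
      ≤ (1 + 2 * x ^ 2) * (n * (x ^ 3 * (12 + 122 * x))) := by
    refine abs_mul_le_mul hN ((abs_inv_pow_sub_inv_pow_le hz hμ1 n).trans ?_)
    exact mul_le_mul_of_nonneg_left hκ (Nat.cast_nonneg n)
  rw [hfin]
  refine (abs_add_le _ _).trans ((add_le_add hC hD).trans (le_of_eq ?_))
  ring

end OneDepSeq

/-! ### Lower bounds for l, K and Γ. -/

/-- Vieta: the roots sum to 0 and have product -1/α < 0. So the middle root is positive, and then t
= 1 + α t^3 ≥ 1. -/
theorem IsSecondRoot.one_le {α t : ℝ} (hα0 : 0 < α) (ht : IsSecondRoot α t) : 1 ≤ t := by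
  obtain ⟨a, b, hat, htb, ha, h, hb⟩ := ht
  have h1 : α * (a ^ 2 + a * t + t ^ 2) = 1 := by
    have : (t - a) * (α * (a ^ 2 + a * t + t ^ 2) - 1) = 0 := by linear_combination h - ha
    rcases mul_eq_zero.1 this with h' | h' <;> linarith
  have h2 : α * (b ^ 2 + b * t + t ^ 2) = 1 := by
    have : (b - t) * (α * (b ^ 2 + b * t + t ^ 2) - 1) = 0 := by linear_combination hb - h
    rcases mul_eq_zero.1 this with h' | h' <;> linarith
  have h3 : a + t + b = 0 := by
    have : α * (b - a) * (a + t + b) = 0 := by linear_combination h2 - h1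
    rcases mul_eq_zero.1 this with h' | h'
    · rcases mul_eq_zero.1 h' with h'' | h'' <;> linarith
    · exact h'
  have h4 : α * (a * t * b) = -1 := by
    have : b = -a - t := by linarith
    subst this
    linear_combination h - t * h1
  have ht0 : 0 < t := by
    by_contra hneg
    have ha0 : a < 0 := by linarith
    have hb0 : 0 < b := by linarith
    have : 0 ≤ α * (a * t * b) :=
      mul_nonneg hα0.le (mul_nonneg (mul_nonneg_of_nonpos_of_nonpos ha0.le (not_lt.1 hneg)) hb0.le)
    linarith
  have : 0 < α * t ^ 3 := by positivity
  linarith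

/-- The fixed point equation t = 1 + α t^3 is iterated from t ≥ 1, giving t ≥ 1 + α and then t ≥ 1 +
α + 3 α^2. -/
theorem IsSecondRoot.le_cube {α t : ℝ} (hα0 : 0 < α) (ht : IsSecondRoot α t) :
    1 + 3 * α + 12 * α ^ 2 ≤ t ^ 3 := by
  have h1 := ht.one_le hα0
  obtain ⟨_, _, _, _, _, h, _⟩ := ht
  have e0 : t = 1 + α * t ^ 3 := by linarith
  have e1 : 1 ≤ t ^ 3 := one_le_pow₀ h1
  have e2 : 1 + α ≤ t := by nlinarith
  have e3 : (1 + α) ^ 3 ≤ t ^ 3 := pow_le_pow_left₀ (by linarith) e2 3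
  have e4 : 1 + 3 * α ≤ t ^ 3 := by nlinarith [pow_pos hα0 3]
  have e5 : 1 + α + 3 * α ^ 2 ≤ t := by nlinarith
  have e6 : (1 + α + 3 * α ^ 2) ^ 3 ≤ t ^ 3 := pow_le_pow_left₀ (by positivity) e5 3
  have e7 : 1 + 3 * α + 12 * α ^ 2 ≤ (1 + α + 3 * α ^ 2) ^ 3 := by
    have : 0 ≤ 19 * α ^ 3 + 36 * α ^ 4 + 27 * α ^ 5 + 27 * α ^ 6 := by positivity
    linarith
  exact e7.trans e6

theorem one_add_le_inv {r : ℝ} (hr : 0 ≤ r) (hr1 : 0 < 1 - r) : 1 + r ≤ 1 / (1 - r) := by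
  rw [le_div_iff₀ hr1]; nlinarith

theorem div_lower {α a d : ℝ} (hα0 : 0 < α) (ha : 15 + 57 * α + 213 * α ^ 2 ≤ a)
    (hd : 2 * α + 6 * α ^ 2 ≤ d) (hd1 : 0 < 1 - d) :
    15 + 87 * α + 400 * α ^ 2 ≤ a / (1 - d) := by
  have hinv : 1 + 2 * α + 10 * α ^ 2 ≤ 1 / (1 - d) := by
    rw [le_div_iff₀ hd1]
    have h1 : 0 ≤ 32 * α ^ 3 + 60 * α ^ 4 := by positivity
    have h2 := mul_le_mul_of_nonneg_left hd (by positivity : 0 ≤ 1 + 2 * α + 10 * α ^ 2)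
    linarith
  rw [div_eq_mul_one_div]
  refine le_trans ?_ (mul_le_mul ha hinv (by positivity) (le_trans (by positivity) ha))
  have h3 : 0 ≤ α ^ 3 := by positivity
  have h4 : 0 ≤ α ^ 4 := by positivity
  nlinarith

theorem coeffK_lower {α l : ℝ} (hα0 : 0 < α) (hα : α ≤ 1 / 10)
    (hl : 1 + 3 * α + 12 * α ^ 2 ≤ l) (hden : DenominatorsPos α l) :
    15 + 87 * α + 400 * α ^ 2 ≤ coeffK α l := by
  obtain ⟨h1, h2, _⟩ := hden
  have hα2 := sq_nonneg α
  have hl1 : 1 ≤ l := by nlinarith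
  have hη : 1 + α ≤ 1 + l * α := by nlinarith
  rw [coeffK]
  set η := 1 + l * α with hηd
  have hη1 : 1 ≤ η := by linarith
  have hη2 : 1 + 2 * α ≤ η ^ 2 := by nlinarith
  have hr0 : α * (1 + 2 * α) ≤ α * η ^ 2 := mul_le_mul_of_nonneg_left hη2 hα0.le
  obtain ⟨v, hv⟩ : ∃ v, v = 1 / (1 - α * η ^ 2) := ⟨_, rfl⟩
  have hv1 : 1 + α * (1 + 2 * α) ≤ v := by
    rw [hv]; exact le_trans (by linarith) (one_add_le_inv (by positivity) h1)
  have hv0 : 0 ≤ v := le_trans (by positivity) hv1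
  have hvm : (1 - α * η ^ 2) * v = 1 := by rw [hv]; field_simp
  have hv2 : 1 + 2 * α + 5 * α ^ 2 ≤ v ^ 2 := by
    have := pow_le_pow_left₀ (by positivity) hv1 2
    have : 0 ≤ 4 * α ^ 3 + 4 * α ^ 4 := by positivity
    linarith
  have hv3 : 1 + 3 * α ≤ v ^ 3 := by
    have := pow_le_pow_left₀ (by positivity) hv1 3
    have h5 : 1 + 3 * α ≤ (1 + α * (1 + 2 * α)) ^ 3 := by
      have := one_add_mul_le_pow (a := α * (1 + 2 * α)) (by nlinarith) 3
      norm_num at this; nlinarith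
    linarith
  have hA : 11 + 19 * α + 27 * α ^ 2 ≤ (11 - 3 * α) / (1 - α) ^ 2 := by
    rw [le_div_iff₀ (by nlinarith)]
    have : 0 ≤ α ^ 3 * (35 - 27 * α) := mul_nonneg (by positivity) (by linarith)
    linarith
  have hB1 : 2 + 4 * α + 10 * α ^ 2 + 3 * α * (1 + 3 * α) ≤
      (2 + 3 * l * α - α * (2 - l * α) * η ^ 2) / (1 - α * η ^ 2) ^ 3 := by
    -- Writing the numerator as 2 (1 - α η^2) + 3 l α + l α (α η^2) removes the negative term, so
    -- that lower bounds for `l`, `η` and `v` can be inserted.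
    have e : (2 + 3 * l * α - α * (2 - l * α) * η ^ 2) / (1 - α * η ^ 2) ^ 3
        = 2 * v ^ 2 + 3 * (l * α) * v ^ 3 + l * α * (α * η ^ 2) * v ^ 3 := by
      rw [hv]; field_simp; ring
    rw [e]
    have f1 : α * (1 + 3 * α) ≤ l * α * v ^ 3 :=
      mul_le_mul (by nlinarith) hv3 (by positivity) (by positivity)
    have f2 : 0 ≤ l * α * (α * η ^ 2) * v ^ 3 := by positivity
    linarith
  have hB2 : 2 * (1 + 3 * α + 12 * α ^ 2) * (1 + 3 * α) ≤ 2 * l * (1 + 3 * α) :=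
    mul_le_mul_of_nonneg_right (by linarith) (by positivity)
  have hB := mul_le_mul hB2 hB1 (by positivity) (by positivity)
  have hAB : 15 + 57 * α + 213 * α ^ 2 ≤ (11 - 3 * α) / (1 - α) ^ 2 + 2 * l * (1 + 3 * α) *
        ((2 + 3 * l * α - α * (2 - l * α) * η ^ 2) / (1 - α * η ^ 2) ^ 3) := by
    have a3 := pow_pos hα0 3
    have a4 := pow_pos hα0 4
    have a2 := pow_pos hα0 2
    have hB' : 4 + 38 * α + 186 * α ^ 2 ≤ 2 * (1 + 3 * α + 12 * α ^ 2) * (1 + 3 * α) *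
        (2 + 4 * α + 10 * α ^ 2 + 3 * α * (1 + 3 * α)) := by
      ring_nf
      have a5 := pow_pos hα0 5
      linarith
    linarith
  have hv2' : 1 + 2 * α ≤ v ^ 2 := by linarith
  have hD : 2 * α + 6 * α ^ 2 ≤ 2 * α * η / (1 - α * η ^ 2) ^ 2 := by
    have e : 2 * α * η / (1 - α * η ^ 2) ^ 2 = 2 * α * (η * v ^ 2) := by
      rw [hv]; field_simp
    rw [e]
    have h4 : (1 + α) * (1 + 2 * α) ≤ η * v ^ 2 := mul_le_mul hη hv2' (by positivity) (by linarith)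
    have h5 := mul_le_mul_of_nonneg_left h4 (by positivity : 0 ≤ 2 * α)
    have a3 := pow_pos hα0 3
    linarith
  exact div_lower hα0 hAB hD h2

/-- Raising η increases each factor of the numerator and decreases those of the denominator while
they stay positive. So η may be replaced by 1 + α, which leaves a polynomial inequality in α. -/
theorem coeffE_lower {α η : ℝ} (hα0 : 0 < α) (hα : α ≤ 1 / 10) (hη : 1 + α ≤ η)
    (h1 : 0 < 1 - α * η ^ 2)
    (h3 : 0 < (1 - α * η ^ 2) ^ 2 - α * η ^ 2 * (1 + η - 2 * α * η) ^ 2) :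
    24.1 + 288 * α + 2000 * α ^ 2 ≤ coeffE α η := by
  have hc : 0 ≤ 1 - 2 * α := by linarith
  have hη0 : 0 ≤ 1 + α := by linarith
  have hη2 : (1 + α) ^ 2 ≤ η ^ 2 := pow_le_pow_left₀ hη0 hη 2
  have n1 : (1 + α) ^ 5 ≤ η ^ 5 := pow_le_pow_left₀ hη0 hη 5
  have n2 : (1 - 2 * α) * (1 + α) ≤ (1 - 2 * α) * η := mul_le_mul_of_nonneg_left hη hc
  have p2 : 0 ≤ (1 - 2 * α) * (1 + α) := mul_nonneg hc hη0
  have n3 : (1 + (1 - 2 * α) * (1 + α)) ^ 4 ≤ (1 + (1 - 2 * α) * η) ^ 4 :=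
    pow_le_pow_left₀ (by linarith) (by linarith) 4
  have n4 : 1 + α * (1 + α - 2) ≤ 1 + α * (η - 2) := by
    have := mul_le_mul_of_nonneg_left hη hα0.le
    linarith
  have p4 : 0 ≤ 1 + α * (1 + α - 2) := by nlinarith
  have hc3 : 0 ≤ 1 - 3 * α := by linarith
  have n5 : 1 + (1 + α) + (1 - 3 * α) * (1 + α) ^ 2 ≤ 1 + η + (1 - 3 * α) * η ^ 2 := by
    have := mul_le_mul_of_nonneg_left hη2 hc3
    linarith
  have p5 : 0 ≤ 1 + (1 + α) + (1 - 3 * α) * (1 + α) ^ 2 := by positivity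
  have hnum : (1 + α) ^ 5 * (1 + (1 - 2 * α) * (1 + α)) ^ 4 * (1 + α * (1 + α - 2)) *
      (1 + (1 + α) + (1 - 3 * α) * (1 + α) ^ 2) ≤
      η ^ 5 * (1 + (1 - 2 * α) * η) ^ 4 * (1 + α * (η - 2)) * (1 + η + (1 - 3 * α) * η ^ 2) := by
    have hη' : 0 ≤ η := hη0.trans hη
    have c2 : 0 ≤ (1 + (1 - 2 * α) * η) ^ 4 := by positivity
    have p4' := p4.trans n4
    exact mul_le_mul (mul_le_mul (mul_le_mul n1 n3 (by positivity) (by positivity)) n4 p4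
      (by positivity)) n5 p5 (mul_nonneg (by positivity) p4')
  have hr : α * (1 + α) ^ 2 ≤ α * η ^ 2 := mul_le_mul_of_nonneg_left hη2 hα0.le
  have d1 : 1 - α * η ^ 2 ≤ 1 - α * (1 + α) ^ 2 := by linarith
  have d2 : (1 - α * η ^ 2) ^ 4 ≤ (1 - α * (1 + α) ^ 2) ^ 4 := pow_le_pow_left₀ h1.le d1 4
  have d3 : (1 - α * η ^ 2) ^ 2 ≤ (1 - α * (1 + α) ^ 2) ^ 2 := pow_le_pow_left₀ h1.le d1 2
  have d4 : (1 + (1 - 2 * α) * (1 + α)) ^ 2 ≤ (1 + η - 2 * α * η) ^ 2 :=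
    pow_le_pow_left₀ (by linarith) (by linarith) 2
  have d5 := mul_le_mul hr d4 (by positivity) (by positivity)
  have hden : 2 * (1 - α * η ^ 2) ^ 4 *
      ((1 - α * η ^ 2) ^ 2 - α * η ^ 2 * (1 + η - 2 * α * η) ^ 2) ≤
      2 * (1 - α * (1 + α) ^ 2) ^ 4 * ((1 - α * (1 + α) ^ 2) ^ 2 -
        α * (1 + α) ^ 2 * (1 + (1 - 2 * α) * (1 + α)) ^ 2) :=
    mul_le_mul (by linarith) (by linarith) h3.le (by positivity)
  have hdpos : 0 < 2 * (1 - α * η ^ 2) ^ 4 *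
      ((1 - α * η ^ 2) ^ 2 - α * η ^ 2 * (1 + η - 2 * α * η) ^ 2) := by positivity
  have hmain : (24 + 288 * α + 2000 * α ^ 2) * (2 * (1 - α * (1 + α) ^ 2) ^ 4 *
      ((1 - α * (1 + α) ^ 2) ^ 2 - α * (1 + α) ^ 2 * (1 + (1 - 2 * α) * (1 + α)) ^ 2)) ≤
      (1 + α) ^ 5 * (1 + (1 - 2 * α) * (1 + α)) ^ 4 * (1 + α * (1 + α - 2)) *
      (1 + (1 + α) + (1 - 3 * α) * (1 + α) ^ 2) := by
    -- Since α ≤ 1/10, each power is at most a tenth of the preceding one, so the low order terms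
    -- absorb the rest of the expansion linearly.
    have step : ∀ k : ℕ, α ^ (k + 1) ≤ α ^ k / 10 := fun k => by
      have := mul_le_mul_of_nonneg_left hα (pow_nonneg hα0.le k)
      rw [pow_succ]; linarith
    have s2 := step 2
    have s3 := step 3
    have s4 := step 4
    have s5 := step 5
    have s6 := step 6
    have s7 := step 7
    have s8 := step 8
    have s9 := step 9
    have s10 := step 10
    have s11 := step 11
    have s12 := step 12
    have s13 := step 13
    have s14 := step 14
    have s15 := step 15
    have s16 := step 16
    have s17 := step 17
    have s18 := step 18
    have s19 := step 19
    have s20 := step 20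
    have s21 := step 21
    have s22 := step 22
    have s23 : 0 ≤ α ^ 23 := by positivity
    norm_num at s2 s3 s4 s5 s6 s7 s8 s9 s10 s11 s12 s13 s14 s15 s16 s17 s18 s19 s20 s21 s22
    rw [← sub_nonneg]
    ring_nf
    linarith
  have hfrac := (le_div_iff₀ hdpos).2
    ((mul_le_mul_of_nonneg_left hden (by positivity)).trans (hmain.trans hnum))
  rw [coeffE]
  linarith

theorem coeffGamma_lower {α l : ℝ} (hα0 : 0 < α) (hα : α ≤ 1 / 10)
    (hl : 1 + 3 * α + 12 * α ^ 2 ≤ l) (hden : DenominatorsPos α l) :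
    124 + 675 * α + 4000 * α ^ 2 ≤ coeffGamma α l := by
  have hK := coeffK_lower hα0 hα hl hden
  obtain ⟨h1, _, h3⟩ := hden
  have hη : 1 + α ≤ 1 + l * α := by
    have : 1 ≤ l := by nlinarith
    nlinarith
  have hE := coeffE_lower hα0 hα hη h1 h3
  have hL : 100 + 387 * α + 2000 * α ^ 2 ≤ coeffL α l := by
    rw [coeffL]
    set K := coeffK α l
    have hK0 : 0 ≤ K := le_trans (by positivity) hK
    have a1 : (15 + 87 * α + 400 * α ^ 2) * (1 + α + 3 * α ^ 2) ≤ K * (1 + α + 3 * α ^ 2) :=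
      mul_le_mul_of_nonneg_right hK (by positivity)
    have a2 := mul_le_mul_of_nonneg_right a1 (by positivity : 0 ≤ 1 + α + 3 * α ^ 2)
    have a3 : 0 ≤ K * (1 + α + 3 * α ^ 2) * (K * α ^ 3) := by positivity
    have a4 : 0 ≤ α ^ 6 * K ^ 3 := by positivity
    have a5 : 0 ≤ α ^ 3 := by positivity
    have a6 : 0 ≤ α ^ 4 := by positivity
    have a7 : 0 ≤ α ^ 5 := by positivity
    have a8 : 0 ≤ α ^ 6 := by positivity
    nlinarith
  rw [coeffGamma]
  linarith

/-- The constants of the theorem dominate explicit polynomials in any `x ≤ α`. -/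
theorem coeff_dominate {α l x : ℝ} (hα0 : 0 < α) (hα : α ≤ 1 / 10)
    (hl : 1 + 3 * α + 12 * α ^ 2 ≤ l) (hden : DenominatorsPos α l) (hx0 : 0 ≤ x) (hx : x ≤ α) :
    105 + 1162 * x ≤ coeffGamma α l ∧ (1 + 2 * x ^ 2) * (12 + 122 * x) ≤ coeffK α l := by
  have hK := coeffK_lower hα0 hα hl hden
  have hΓ := coeffGamma_lower hα0 hα hl hden
  constructor
  -- The difference is at least 19 - 487 α + 4000 α^2, which has negative discriminant and its
  -- minimum near 0.06. The quadratic term is indispensable, as the slope 675 is below 1162; the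
  -- same holds for K, with minimum near 0.05.
  · nlinarith [sq_nonneg (α - 0.06)]
  · have h1 : x ^ 2 ≤ α ^ 2 := pow_le_pow_left₀ hx0 hx 2
    have h2 : (1 + 2 * x ^ 2) * (12 + 122 * x) ≤ (1 + 2 * α ^ 2) * (12 + 122 * α) :=
      mul_le_mul (by linarith) (by linarith) (by positivity) (by positivity)
    have h3 : α ^ 2 * α ≤ α ^ 2 * (1 / 10) := mul_le_mul_of_nonneg_left hα (sq_nonneg α)
    nlinarith [sq_nonneg (α - 0.05)]

/-! ### From the one-dependent process to the numerical sequences. -/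

section Probability

theorem measurableSet_forall_mem {Ω : Type*} {X : ℕ → Ω → ℝ} {I : Set ℕ} {J : Finset ℕ} (hJ : ∀ i ∈ J, i ∈ I) {T : Set ℝ}
    (hT : MeasurableSet T) :
    MeasurableSet[⨆ i ∈ I, MeasurableSpace.comap (X i) inferInstance]
      {ω | ∀ i ∈ J, X i ω ∈ T} := by
  have : {ω | ∀ i ∈ J, X i ω ∈ T} = ⋂ i ∈ J, X i ⁻¹' T := by ext; simp
  rw [this]
  refine Finset.measurableSet_biInter J fun i hi => ?_
  exact le_iSup₂ (f := fun i (_ : i ∈ I) => MeasurableSpace.comap (X i) inferInstance) i (hJ i hi)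
    _ ⟨T, hT, rfl⟩

variable {Ω : Type*} [MeasurableSpace Ω] {μ : Measure Ω} {X : ℕ → Ω → ℝ}

/-- Independence of events carried by two blocks of indices separated by a gap. -/
theorem OneDependent.measureReal_inter (hdep : OneDependent X μ) {t : ℕ} (ht : 1 ≤ t)
    {J K : Finset ℕ} (hJ : ∀ i ∈ J, i < t) (hK : ∀ i ∈ K, t + 1 ≤ i) {S T : Set ℝ}
    (hS : MeasurableSet S) (hT : MeasurableSet T) :
    μ.real ({ω | ∀ i ∈ J, X i ω ∈ S} ∩ {ω | ∀ i ∈ K, X i ω ∈ T}) =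
      μ.real {ω | ∀ i ∈ J, X i ω ∈ S} * μ.real {ω | ∀ i ∈ K, X i ω ∈ T} := by
  have := (Indep_iff _ _ μ).1 (hdep t ht) _ _ (measurableSet_forall_mem hJ hS)
    (measurableSet_forall_mem hK hT)
  simp only [measureReal_def, this, ENNReal.toReal_mul]

/-- Stationarity for blocks. -/
theorem StrictlyStationary.measureReal_block (hstat : StrictlyStationary X μ)
    (hX : ∀ i, Measurable (X i)) {T : Set ℝ} (hT : MeasurableSet T) (h k : ℕ) :
    μ.real {ω | ∀ i ∈ Finset.Ico h (h + k), X i ω ∈ T} =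
      μ.real {ω | ∀ i ∈ Finset.range k, X i ω ∈ T} := by
  have hS : MeasurableSet {f : Fin k → ℝ | ∀ i, f i ∈ T} := by
    have : {f : Fin k → ℝ | ∀ i, f i ∈ T} = ⋂ i, (fun f : Fin k → ℝ => f i) ⁻¹' T := by ext; simp
    rw [this]
    exact MeasurableSet.iInter fun i => measurable_pi_apply i hT
  have h1 := congrArg (fun ν => ν {f : Fin k → ℝ | ∀ i, f i ∈ T}) (hstat k h)
  rw [Measure.map_apply (measurable_pi_lambda _ fun i => hX _) hS,
    Measure.map_apply (measurable_pi_lambda _ fun i => hX _) hS] at h1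
  have e1 : {ω | ∀ i ∈ Finset.Ico h (h + k), X i ω ∈ T}
      = (fun ω (i : Fin k) => X (i + h) ω) ⁻¹' {f | ∀ i, f i ∈ T} := by
    ext ω
    simp only [Set.mem_ofPred_eq, Set.mem_preimage, Finset.mem_Ico]
    constructor
    · intro H i
      exact H _ (by omega)
    · intro H i hi
      have := H ⟨i - h, by omega⟩
      simpa [Nat.sub_add_cancel hi.1] using this
  have e2 : {ω | ∀ i ∈ Finset.range k, X i ω ∈ T}
      = (fun ω (i : Fin k) => X i ω) ⁻¹' {f | ∀ i, f i ∈ T} := by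
    ext ω
    simp only [Set.mem_ofPred_eq, Set.mem_preimage, Finset.mem_range]
    exact ⟨fun H i => H _ i.2, fun H i hi => H ⟨i, hi⟩⟩
  rw [measureReal_def, measureReal_def, e1, e2, h1]

/-- The probability that the first `m` variables are at most `x` and the next `k` exceed `x`. -/
noncomputable def blockProb (X : ℕ → Ω → ℝ) (μ : Measure Ω) (x : ℝ) (m k : ℕ) : ℝ :=
  μ.real ({ω | ∀ i ∈ Finset.range m, X i ω ∈ Set.Iic x} ∩
    {ω | ∀ i ∈ Finset.Ico m (m + k), X i ω ∈ Set.Ioi x})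

theorem blockProb_zero_right (x : ℝ) (m : ℕ) : blockProb X μ x m 0 = maxCDF X μ m x := by
  simp [blockProb, maxCDF]

theorem blockProb_zero_left (x : ℝ) (k : ℕ) :
    blockProb X μ x 0 k = μ.real {ω | ∀ i ∈ Finset.range k, X i ω ∈ Set.Ioi x} := by
  simp [blockProb]

variable [IsProbabilityMeasure μ]

/-- The two events on the left split, according to the variable with index `m`, the event that
leaves this variable free. With the gap at `m` the two blocks are independent. -/
theorem blockProb_add (hX : ∀ i, Measurable (X i)) (hstat : StrictlyStationary X μ)
    (hdep : OneDependent X μ) (x : ℝ) (m k : ℕ) :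
    blockProb X μ x (m + 1) k + blockProb X μ x m (k + 1)
      = blockProb X μ x m 0 * blockProb X μ x 0 k := by
  have hmeas : MeasurableSet {ω | X m ω ∈ Set.Iic x} := hX m measurableSet_Iic
  have hsplit := measureReal_inter_add_sdiff (μ := μ) (s :=
    {ω | ∀ i ∈ Finset.range m, X i ω ∈ Set.Iic x} ∩
      {ω | ∀ i ∈ Finset.Ico (m + 1) (m + 1 + k), X i ω ∈ Set.Ioi x}) hmeas
  have e1 : ({ω | ∀ i ∈ Finset.range m, X i ω ∈ Set.Iic x} ∩
      {ω | ∀ i ∈ Finset.Ico (m + 1) (m + 1 + k), X i ω ∈ Set.Ioi x}) ∩ {ω | X m ω ∈ Set.Iic x}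
      = {ω | ∀ i ∈ Finset.range (m + 1), X i ω ∈ Set.Iic x} ∩
      {ω | ∀ i ∈ Finset.Ico (m + 1) (m + 1 + k), X i ω ∈ Set.Ioi x} := by
    ext ω
    simp only [Set.mem_inter_iff, Set.mem_ofPred_eq, Finset.range_add_one, Finset.forall_mem_insert]
    tauto
  have e2 : ({ω | ∀ i ∈ Finset.range m, X i ω ∈ Set.Iic x} ∩
      {ω | ∀ i ∈ Finset.Ico (m + 1) (m + 1 + k), X i ω ∈ Set.Ioi x}) \ {ω | X m ω ∈ Set.Iic x}
      = {ω | ∀ i ∈ Finset.range m, X i ω ∈ Set.Iic x} ∩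
      {ω | ∀ i ∈ Finset.Ico m (m + (k + 1)), X i ω ∈ Set.Ioi x} := by
    ext ω
    rw [← Finset.insert_Ico_add_one_left_eq_Ico (by omega : m < m + (k + 1)),
      show m + (k + 1) = m + 1 + k by ring]
    simp only [Set.mem_inter_iff, Set.mem_sdiff, Set.mem_ofPred_eq, Finset.forall_mem_insert,
      Set.mem_Iic, Set.mem_Ioi, not_le]
    tauto
  rw [e1, e2] at hsplit
  rw [blockProb, blockProb, hsplit, blockProb_zero_left,
    ← hstat.measureReal_block hX measurableSet_Ioi (m + 1) k]
  -- One-dependence is only available for t ≥ 1, so an empty left block is treated apart.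
  rcases m with _ | m
  · simp [blockProb]
  · rw [hdep.measureReal_inter (Nat.le_add_left 1 m) (fun i hi => Finset.mem_range.1 hi)
      (fun i hi => (Finset.mem_Ico.1 hi).1) measurableSet_Iic measurableSet_Ioi]
    simp [blockProb]

/-- The block probabilities of a one-dependent stationary sequence form a `OneDepSeq`. -/
theorem oneDepSeq_blockProb (hX : ∀ i, Measurable (X i)) (hstat : StrictlyStationary X μ)
    (hdep : OneDependent X μ) {x : ℝ} (hq : 0.9 ≤ maxCDF X μ 1 x) :
    OneDepSeq (fun k => blockProb X μ x 0 k) (fun n => maxCDF X μ n x) where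
  p_zero := by simp [blockProb]
  p_nonneg k := measureReal_nonneg
  p_anti k := by
    simp only [blockProb_zero_left]
    exact measureReal_mono fun ω h i hi => h i (Finset.mem_range.2
      (by have := Finset.mem_range.1 hi; omega))
  p_two k := by
    simp only [blockProb_zero_left]
    rcases k with _ | k
    · rw [show {ω | ∀ i ∈ Finset.range 0, X i ω ∈ Set.Ioi x} = Set.univ by simp, probReal_univ,
        one_mul]
      exact measureReal_mono fun ω h i hi => h i (Finset.mem_range.2
        (by have := Finset.mem_range.1 hi; omega))
    -- The condition on the variable with index `k + 1` is dropped; it is the gap that makes the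
    -- last variable independent of the earlier ones.
    · rw [← hstat.measureReal_block hX measurableSet_Ioi (k + 1 + 1) 1,
        ← hdep.measureReal_inter (Nat.le_add_left 1 k) (fun i hi => Finset.mem_range.1 hi)
        (fun i hi => (Finset.mem_Ico.1 hi).1) measurableSet_Ioi measurableSet_Ioi]
      exact measureReal_mono fun ω h => ⟨fun i hi => h i (Finset.mem_range.2
        (by have := Finset.mem_range.1 hi; omega)), fun i hi => h i (Finset.mem_range.2
        (by have := Finset.mem_Ico.1 hi; omega))⟩
  p_one := by
    have h := blockProb_add hX hstat hdep x 0 0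
    have h0 : blockProb X μ x 0 0 = 1 := by simp [blockProb]
    rw [h0, zero_add, blockProb_zero_right] at h
    norm_num at hq h ⊢
    linarith
  q_nonneg k := measureReal_nonneg
  conv n := by
    rw [Finset.Nat.sum_antidiagonal_succ, Finset.Nat.sum_antidiagonal_eq_sum_range_succ_mk,
      Finset.sum_range_succ]
    -- By `blockProb_add` each product p_k q_(n-1-k) is a sum of two adjacent block probabilities;
    -- with alternating signs the sum telescopes, and the two boundary terms of the convolution
    -- cancel what remains.
    have h : ∀ k ∈ Finset.range n,
        signedCoeff (fun k => blockProb X μ x 0 k) (k + 1)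
          * shiftedCoeff (fun n => maxCDF X μ n x) (n - k)
        = (-1) ^ (k + 1) * blockProb X μ x (n - k) k
          - (-1) ^ (k + 1 + 1) * blockProb X μ x (n - (k + 1)) (k + 1) := by
      intro k hk
      have hk' := Finset.mem_range.1 hk
      have hb := blockProb_add hX hstat hdep x (n - (k + 1)) k
      rw [show n - (k + 1) + 1 = n - k by omega, blockProb_zero_right] at hb
      rw [show n - k = n - (k + 1) + 1 by omega, signedCoeff, shiftedCoeff,
        show n - (k + 1) + 1 = n - k by omega, pow_succ _ (k + 1)]
      linear_combination -(-1) ^ (k + 1) * hb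
    rw [Finset.sum_congr rfl h,
      Finset.sum_range_sub' (fun k => (-1) ^ (k + 1) * blockProb X μ x (n - k) k)]
    simp only [signedCoeff, shiftedCoeff, Nat.sub_self, Nat.sub_zero, blockProb_zero_right]
    ring

end Probability

theorem theoremT3 {Ω : Type*} [MeasurableSpace Ω] (μ : Measure Ω) [IsProbabilityMeasure μ]
    (X : ℕ → Ω → ℝ) (hX : ∀ i, Measurable (X i))
    (hstat : StrictlyStationary X μ) (hdep : OneDependent X μ)
    (x α t₂ l : ℝ) (hα0 : 0 < α) (hα : 0.9 ≤ 1 - α) (hq : 1 - α ≤ maxCDF X μ 1 x)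
    (ht₂ : IsSecondRoot α t₂) (hl : t₂ ^ 3 < l) (hden : DenominatorsPos α l)
    (n : ℕ) (hn : 3 ≤ n) :
    |maxCDF X μ n x -
        (6 * (maxCDF X μ 1 x - maxCDF X μ 2 x) ^ 2 + 4 * maxCDF X μ 3 x - 3 * maxCDF X μ 4 x) /
          (1 + maxCDF X μ 1 x - maxCDF X μ 2 x + maxCDF X μ 3 x - maxCDF X μ 4 x +
            2 * maxCDF X μ 1 x ^ 2 + 3 * maxCDF X μ 2 x ^ 2 -
            5 * maxCDF X μ 1 x * maxCDF X μ 2 x) ^ n|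
      ≤ (coeffGamma α l + n * coeffK α l) * (1 - maxCDF X μ 1 x) ^ 3 := by

  have hα1 : α ≤ 1 / 10 := by norm_num at hα; linarith
  have hq9 : 0.9 ≤ maxCDF X μ 1 x := hα.trans hq
  have H := oneDepSeq_blockProb hX hstat hdep hq9
  have hq1 := H.q_one
  have hx0 := H.p_nonneg 1
  have h := H.approx hn
  have hl' := (ht₂.le_cube hα0).trans hl.le
  beta_reduce at hq1 hx0 h
  have hp1 : 1 - maxCDF X μ 1 x = blockProb X μ x 0 1 := by linarith
  obtain ⟨hΓ, hK⟩ := coeff_dominate hα0 hα1 hl' hden hx0 (by linarith)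
  rw [hp1]
  refine h.trans (mul_le_mul_of_nonneg_right ?_ (pow_nonneg hx0 3))
  exact add_le_add hΓ (mul_le_mul_of_nonneg_left hK (Nat.cast_nonneg n))
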